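/- Let $\Omega\subset\mathbb{R}^d$ be a bounded Lipschitz domain (bounded, open, connected, nonempty, and near each boundary point, up to a rotation, the strict epigraph of a Lipschitz function), and let $f^+,f^-$ be Borel probability measures on $\overline\Omega$. Let $H_1,H_2:\mathbb{R}^d\to[0,+\infty]$ be continuous convex functions with $H_1\le H_2$ and $H_i(s)/|s|\to+\infty$ as $|s|\to+\infty$ for $i=1,2$. Let $\Gamma_f$ be the set of all $\sigma\in L^1(\Omega;\mathbb{R}^d)$ such that $$\int_\Omega\sigma\cdot\nabla\phi\,dx=\int\phi\,df^+-\int\phi\,df^-\qquad\text{for every }\phi\in C^\infty(\overline\Omega)$$ (that is, $-\operatorname{div}\sigma=f^+-f^-$ in $\Omega$ and $\sigma\cdot n=0$ on $\partial\Omega$ in the weak sense), where $C^\infty(\overline\Omega)$ denotes the restrictions to $\overline\Omega$ of smooth functions on $\mathbb{R}^d$. For a Lebesgue measurable set $C\subset\overline\Omega$ put $$F(C)=\inf_{\sigma\in\Gamma_f}\Big\{\int_{\Omega\setminus C}H_2(\sigma)\,dx+\int_{\Omega\cap C}H_1(\sigma)\,dx\Big\}\in[0,+\infty],$$ with $F(C)=+\infty$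 if no $\sigma\in\Gamma_f$ has finite cost, and let $$\operatorname{Per}(C)=\sup\Big\{\int_C\operatorname{div}\psi\,dx\ :\ \psi\in C^1_c(\mathbb{R}^d;\mathbb{R}^d),\ |\psi|\le1\Big\}\in[0,+\infty]$$ be the De Giorgi perimeter of $C$ (in $\mathbb{R}^d$). Let $k>0$. Assume that there is a Lebesgue measurable set $C\subset\overline\Omega$ with $\operatorname{Per}(C)<+\infty$ and $F(C)<+\infty$. Then for every Lebesgue measurable $C\subset\Omega$ with $F(C)<+\infty$ the infimum defining $F(C)$ is attained (so $F(C)$ is a minimum), and there is a Lebesgue measurable set $C_{opt}\subset\Omega$ with $F(C_{opt})+k\operatorname{Per}(C_{opt})<+\infty$ and $$F(C_{opt})+k\operatorname{Per}(C_{opt})\le F(C)+k\operatorname{Per}(C)\qquad\text{for every Lebesgue measurable }C\subset\Omega.$$ -/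

import Mathlib

open MeasureTheory Set Filter Topology Bornology
open scoped NNReal ENNReal ContDiff InnerProductSpace

namespace CongestedTransport

/-- A bounded Lipschitz domain of `ℝ^d`: a bounded, open, connected (nonempty) set which, near each
boundary point `p` and up to a rotation, is the strict epigraph of a Lipschitz function. Here `v` is
the unit "vertical" direction, `⟪v, x⟫` the vertical coordinate of `x`, and `x - ⟪v, x⟫ • v` its
projection to the hyperplane orthogonal to `v`. -/
structure IsBoundedLipschitzDomain {d : ℕ} (Ω : Set (EuclideanSpace ℝ (Fin d))) : Prop where
  isOpen : IsOpen Ω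
  isConnected : IsConnected Ω
  isBounded : IsBounded Ω
  lipschitz_boundary : ∀ p ∈ frontier Ω,
    ∃ (v : EuclideanSpace ℝ (Fin d)) (g : EuclideanSpace ℝ (Fin d) → ℝ) (L : ℝ≥0) (r : ℝ),
      ‖v‖ = 1 ∧ LipschitzWith L g ∧ 0 < r ∧
        ∀ x ∈ Metric.ball p r, x ∈ Ω ↔ g (x - ⟪v, x⟫_ℝ • v) < ⟪v, x⟫_ℝ

/-- A continuous convex superlinear congestion function `H : ℝ^d → [0, +∞]`, that is with
`H(s) / |s| → +∞` as `|s| → +∞`. (Finite-valued functions are a special case.) -/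
structure IsCongestionFunction {d : ℕ} (H : EuclideanSpace ℝ (Fin d) → ℝ≥0∞) : Prop where
  continuous : Continuous H
  convex : ConvexOn ℝ≥0 univ H
  superlinear : Tendsto (fun s => H s / ‖s‖ₑ) (cobounded (EuclideanSpace ℝ (Fin d))) (𝓝 ⊤)

/-- The set of fluxes `σ ∈ L¹(Ω; ℝ^d)` that solve `-div σ = f⁺ - f⁻` in `Ω`, `σ · n = 0` on `∂Ω`
in the weak sense: `∫_Ω σ · ∇φ dx = ∫ φ df⁺ - ∫ φ df⁻` for all `φ ∈ C^∞(closure Ω)`, these being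
the restrictions of the smooth functions on `ℝ^d`. Note `fderiv ℝ φ x (σ x) = σ(x) · ∇φ(x)`. -/
def admissibleFluxes {d : ℕ} (Ω : Set (EuclideanSpace ℝ (Fin d)))
    (fp fm : Measure (EuclideanSpace ℝ (Fin d))) :
    Set (EuclideanSpace ℝ (Fin d) → EuclideanSpace ℝ (Fin d)) :=
  {σ | IntegrableOn σ Ω ∧ ∀ φ : EuclideanSpace ℝ (Fin d) → ℝ, ContDiff ℝ ∞ φ →
    ∫ x in Ω, fderiv ℝ φ x (σ x) = (∫ x, φ x ∂fp) - ∫ x, φ x ∂fm}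

/-- The total congestion cost of the flux `σ` with low-congestion region `C`:
`∫_{Ω \ C} H₂(σ) dx + ∫_{Ω ∩ C} H₁(σ) dx`. -/
noncomputable def fluxCost {d : ℕ} (Ω : Set (EuclideanSpace ℝ (Fin d)))
    (H₁ H₂ : EuclideanSpace ℝ (Fin d) → ℝ≥0∞) (C : Set (EuclideanSpace ℝ (Fin d)))
    (σ : EuclideanSpace ℝ (Fin d) → EuclideanSpace ℝ (Fin d)) : ℝ≥0∞ :=
  (∫⁻ x in Ω \ C, H₂ (σ x)) + ∫⁻ x in Ω ∩ C, H₁ (σ x)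

/-- The two-phase congested transport cost `F(C)`, the least cost of an admissible flux
(`+∞` if there is none of finite cost). -/
noncomputable def transportCost {d : ℕ} (Ω : Set (EuclideanSpace ℝ (Fin d)))
    (fp fm : Measure (EuclideanSpace ℝ (Fin d)))
    (H₁ H₂ : EuclideanSpace ℝ (Fin d) → ℝ≥0∞) (C : Set (EuclideanSpace ℝ (Fin d))) : ℝ≥0∞ :=
  ⨅ σ ∈ admissibleFluxes Ω fp fm, fluxCost Ω H₁ H₂ C σ

/-- The divergence of a vector field on `ℝ^d`. -/
noncomputable def divergence {d : ℕ} (ψ : EuclideanSpace ℝ (Fin d) → EuclideanSpace ℝ (Fin d))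
    (x : EuclideanSpace ℝ (Fin d)) : ℝ :=
  ∑ i : Fin d, fderiv ℝ ψ x (EuclideanSpace.single i 1) i

/-- The De Giorgi perimeter (in the whole space) of a Lebesgue measurable set `C ⊆ ℝ^d`:
`sup { ∫_C div ψ dx : ψ ∈ C¹_c(ℝ^d; ℝ^d), |ψ| ≤ 1 }`, an element of `[0, +∞]`. -/
noncomputable def perimeter {d : ℕ} (C : Set (EuclideanSpace ℝ (Fin d))) : ℝ≥0∞ :=
  ⨆ (ψ : EuclideanSpace ℝ (Fin d) → EuclideanSpace ℝ (Fin d)) (_ : ContDiff ℝ 1 ψ)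
    (_ : HasCompactSupport ψ) (_ : ∀ x, ‖ψ x‖ ≤ 1), ENNReal.ofReal (∫ x in C, divergence ψ x)

/-- The penalized cost `F(C) + k Per(C)`. -/
noncomputable def penalizedCost {d : ℕ} (Ω : Set (EuclideanSpace ℝ (Fin d)))
    (fp fm : Measure (EuclideanSpace ℝ (Fin d)))
    (H₁ H₂ : EuclideanSpace ℝ (Fin d) → ℝ≥0∞) (k : ℝ) (C : Set (EuclideanSpace ℝ (Fin d))) :
    ℝ≥0∞ :=
  transportCost Ω fp fm H₁ H₂ C + ENNReal.ofReal k * perimeter C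

end CongestedTransport

/-! The proof is the direct method. Along a minimizing sequence of sets the perimeters are bounded,
so a subsequence converges in measure to some `C`; the perimeter is lower semicontinuous
(`perimeter_le_of_tendsto`), and it remains to see that the transport cost is too
(`transportCost_le_limsup`).

For the cost, let `s n` be optimal for `D n`, with `D n` and `C` equal off a set `B n`, where `B n`
decreases to a null set. Off `B n` the cost of `s n` is a convex functional attached to the fixed
set `C`, so the `s n` lie in decreasing convex sets of fluxes. Superlinearity of `H₁` makes these
fluxes uniformly integrable. In place of weak compactness and convex combinations,
`exists_selection_tendsto_L1` takes near-minimizers of the strictly convex functional `∫ √(1 +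
|σ|²)`, finite on `L¹`, over the successive sets: midpoints stay in the earlier set, hence the
convexity gap tends to zero and the selection is Cauchy in `L¹`. Fatou off each `B m`, then monotone
convergence in `m`, bound the cost of the limit. A constant sequence of sets gives existence of an
optimal flux.

Compactness of sets comes from the translation estimate `volume_symmDiff_preimage_add_le`. It bounds
the measure of pairs of nearby points separated by a set, so sets of bounded perimeter are close as
soon as their volumes in small balls are; those volumes converge along a subsequence by weak
compactness in `L²`.

The Lipschitz boundary only serves to make the frontier null, so that a competitor in the closure
can be cut down to `Ω`. -/

namespace CongestedTransport

/-! ### Quantitative strict convexity of `√(1 + |s|²)` -/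

section StrictConvexity

variable {E : Type*} [NormedAddCommGroup E]

/-- The strictly convex function `s ↦ √(1 + |s|²)` of linear growth. -/
noncomputable def japaneseBracket (s : E) : ℝ := √(1 + ‖s‖ ^ 2)

lemma continuous_japaneseBracket : Continuous (japaneseBracket : E → ℝ) := by
  unfold japaneseBracket; fun_prop

lemma japaneseBracket_nonneg (s : E) : 0 ≤ japaneseBracket s := Real.sqrt_nonneg _

lemma japaneseBracket_le (s : E) : japaneseBracket s ≤ 1 + ‖s‖ := by
  unfold japaneseBracket
  rw [Real.sqrt_le_left (by positivity)]
  nlinarith [norm_nonneg s]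

lemma one_le_japaneseBracket (s : E) : 1 ≤ japaneseBracket s := by
  unfold japaneseBracket
  rw [Real.one_le_sqrt]
  nlinarith [norm_nonneg s]

lemma japaneseBracket_sq (s : E) : japaneseBracket s ^ 2 = 1 + ‖s‖ ^ 2 :=
  Real.sq_sqrt (by positivity)

variable [InnerProductSpace ℝ E]

/-- The midpoint convexity gap of `japaneseBracket`. -/
noncomputable def bracketGap (a b : E) : ℝ :=
  (japaneseBracket a + japaneseBracket b) / 2 - japaneseBracket ((1 / 2 : ℝ) • (a + b))

/-- Rationalize twice. With `p`, `q`, `r` the brackets at `a`, `b` and the midpoint, the gap times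
`p + q + 2r` equals `pq - 1 - ⟪a, b⟫`. Multiplying by `pq + 1 + ⟪a, b⟫` gives `|a - b|² + |a|²|b|² -
⟪a, b⟫²`, and Cauchy–Schwarz drops the last two terms. -/
lemma sq_norm_sub_le_two_mul_bracketGap (a b : E) :
    2 * bracketGap a b * ((japaneseBracket a + japaneseBracket b) / 2 +
      japaneseBracket ((1 / 2 : ℝ) • (a + b))) *
      (japaneseBracket a * japaneseBracket b + 1 + ⟪a, b⟫_ℝ) ≥ ‖a - b‖ ^ 2 := by
  have hr := japaneseBracket_sq ((1 / 2 : ℝ) • (a + b))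
  have hp := japaneseBracket_sq a
  have hq := japaneseBracket_sq b
  rw [norm_smul, mul_pow, norm_add_sq_real] at hr
  norm_num at hr
  have hcs : ⟪a, b⟫_ℝ ^ 2 ≤ ‖a‖ ^ 2 * ‖b‖ ^ 2 := by
    rw [← mul_pow]
    exact sq_le_sq' (by linarith [neg_le_of_abs_le (abs_real_inner_le_norm a b)])
      (real_inner_le_norm a b)
  have hgap : 2 * bracketGap a b * ((japaneseBracket a + japaneseBracket b) / 2 +
      japaneseBracket ((1 / 2 : ℝ) • (a + b))) =
      japaneseBracket a * japaneseBracket b - 1 - ⟪a, b⟫_ℝ := by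
    unfold bracketGap
    norm_num
    linear_combination hp / 2 + hq / 2 - 2 * hr
  rw [hgap, norm_sub_sq_real]
  have : (japaneseBracket a * japaneseBracket b) ^ 2 = (1 + ‖a‖ ^ 2) * (1 + ‖b‖ ^ 2) := by
    rw [mul_pow, hp, hq]
  nlinarith

lemma japaneseBracket_mul_add_inner_pos (a b : E) :
    0 < japaneseBracket a * japaneseBracket b + 1 + ⟪a, b⟫_ℝ := by
  have h1 := neg_le_of_abs_le (abs_real_inner_le_norm a b)
  have h2 : ‖a‖ ≤ japaneseBracket a := Real.le_sqrt_of_sq_le (by linarith)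
  have h3 : ‖b‖ ≤ japaneseBracket b := Real.le_sqrt_of_sq_le (by linarith)
  have := mul_le_mul h2 h3 (norm_nonneg _) (japaneseBracket_nonneg _)
  linarith

lemma bracketGap_nonneg (a b : E) : 0 ≤ bracketGap a b := by
  by_contra! h
  have h1 := sq_norm_sub_le_two_mul_bracketGap a b
  have h2 := japaneseBracket_mul_add_inner_pos a b
  have h3 : 0 < (japaneseBracket a + japaneseBracket b) / 2 +
      japaneseBracket ((1 / 2 : ℝ) • (a + b)) := by
    linarith [one_le_japaneseBracket a, one_le_japaneseBracket b,
      one_le_japaneseBracket ((1 / 2 : ℝ) • (a + b))]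
  have := mul_neg_of_neg_of_pos (mul_neg_of_neg_of_pos (by linarith : 2 * bracketGap a b < 0) h3) h2
  nlinarith [sq_nonneg ‖a - b‖]

lemma sq_norm_sub_le_bracketGap {a b : E} {R : ℝ} (ha : ‖a‖ ≤ R) (hb : ‖b‖ ≤ R) :
    ‖a - b‖ ^ 2 ≤ 8 * (1 + R) ^ 3 * bracketGap a b := by
  have hR : 0 ≤ R := (norm_nonneg a).trans ha
  have hg := bracketGap_nonneg a b
  have hm : ‖(1 / 2 : ℝ) • (a + b)‖ ≤ R := by
    rw [norm_smul]; norm_num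
    linarith [norm_add_le a b]
  have hp := (japaneseBracket_le a).trans (by linarith : 1 + ‖a‖ ≤ 1 + R)
  have hq := (japaneseBracket_le b).trans (by linarith : 1 + ‖b‖ ≤ 1 + R)
  have hr := (japaneseBracket_le _).trans (by linarith : 1 + ‖(1 / 2 : ℝ) • (a + b)‖ ≤ 1 + R)
  have hi : ⟪a, b⟫_ℝ ≤ R * R := (real_inner_le_norm a b).trans (by gcongr)
  have hpq : japaneseBracket a * japaneseBracket b ≤ (1 + R) * (1 + R) := by
    gcongr; exact japaneseBracket_nonneg _
  calc ‖a - b‖ ^ 2 ≤ _ := sq_norm_sub_le_two_mul_bracketGap a b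
    _ ≤ 2 * bracketGap a b * (2 * (1 + R)) * (2 * (1 + R) ^ 2) := by
      have := japaneseBracket_mul_add_inner_pos a b
      gcongr
      · linarith
      · nlinarith
    _ = _ := by ring

/-- If both norms are at most `R`, use `t ≤ δ + t² / (4δ)` and the quadratic bound; otherwise the
larger norm exceeds `R` and twice its tail dominates `‖a‖ + ‖b‖`. Being linear in the gap and in the
tails, the bound can be integrated. -/
lemma norm_sub_le_bracketGap (a b : E) {R δ : ℝ} (hR : 0 ≤ R) (hδ : 0 < δ) :
    ‖a - b‖ ≤ δ + 2 * (1 + R) ^ 3 / δ * bracketGap a b +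
      2 * {s : E | R < ‖s‖}.indicator norm a + 2 * {s : E | R < ‖s‖}.indicator norm b := by
  have hg := bracketGap_nonneg a b
  have ia : 0 ≤ {s : E | R < ‖s‖}.indicator norm a := indicator_nonneg (fun _ _ => norm_nonneg _) _
  have ib : 0 ≤ {s : E | R < ‖s‖}.indicator norm b := indicator_nonneg (fun _ _ => norm_nonneg _) _
  have hc : 0 ≤ 2 * (1 + R) ^ 3 / δ * bracketGap a b := by positivity
  by_cases h : ‖a‖ ≤ R ∧ ‖b‖ ≤ R
  · have h1 := sq_norm_sub_le_bracketGap h.1 h.2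
    have h2 : ‖a - b‖ ≤ δ + ‖a - b‖ ^ 2 / (4 * δ) := by
      have : δ + ‖a - b‖ ^ 2 / (4 * δ) - ‖a - b‖ = (2 * δ - ‖a - b‖) ^ 2 / (4 * δ) := by
        field_simp; ring
      have : 0 ≤ (2 * δ - ‖a - b‖) ^ 2 / (4 * δ) := by positivity
      linarith
    have h3 : ‖a - b‖ ^ 2 / (4 * δ) ≤ 2 * (1 + R) ^ 3 / δ * bracketGap a b := by
      rw [div_le_iff₀ (by positivity)]
      calc _ ≤ _ := h1
        _ = _ := by field_simp; ring
    linarith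
  · have hab := norm_sub_le a b
    have key : ‖a‖ + ‖b‖ ≤ 2 * {s : E | R < ‖s‖}.indicator norm a +
        2 * {s : E | R < ‖s‖}.indicator norm b := by
      rcases le_total ‖a‖ ‖b‖ with hle | hle
      · have : b ∈ {s : E | R < ‖s‖} := by
          by_contra hb
          simp only [mem_ofPred_eq, not_lt] at hb
          exact h ⟨hle.trans hb, hb⟩
        rw [indicator_of_mem this]; linarith
      · have : a ∈ {s : E | R < ‖s‖} := by
          by_contra ha
          simp only [mem_ofPred_eq, not_lt] at ha
          exact h ⟨ha, hle.trans ha⟩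
        rw [indicator_of_mem this]; linarith
    linarith

end StrictConvexity

/-! ### Strongly convergent selections from decreasing convex sets -/

section Selection

variable {α E : Type*} [MeasurableSpace α] [NormedAddCommGroup E] {μ : Measure α}

lemma integrable_indicator_norm [MeasurableSpace E] [BorelSpace E] {σ : α → E}
    (h : Integrable σ μ) (R : ℝ) :
    Integrable (fun x => {s : E | R < ‖s‖}.indicator norm (σ x)) μ := by
  have hm : MeasurableSet {s : E | R < ‖s‖} := measurableSet_lt measurable_const measurable_norm
  refine h.norm.mono' ((measurable_norm.indicator hm).comp_aemeasurable
    ?_).aestronglyMeasurable ?_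
  · exact h.aestronglyMeasurable.aemeasurable
  · filter_upwards with x
    rw [norm_indicator_eq_indicator_norm]
    simpa using indicator_le_self' (fun _ _ => norm_nonneg _) (σ x)

lemma integrable_japaneseBracket [IsFiniteMeasure μ] {σ : α → E} (h : Integrable σ μ) :
    Integrable (fun x => japaneseBracket (σ x)) μ := by
  refine ((integrable_const (1 : ℝ)).add h.norm).mono'
    (continuous_japaneseBracket.comp_aestronglyMeasurable h.aestronglyMeasurable) ?_
  filter_upwards with x
  rw [Real.norm_of_nonneg (japaneseBracket_nonneg _)]
  exact japaneseBracket_le _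

lemma exists_tendsto_L1_of_cauchy [CompleteSpace E] {y : ℕ → α → E}
    (hy : ∀ n, Integrable (y n) μ)
    (hc : ∀ ε > 0, ∃ N, ∀ n ≥ N, ∀ m ≥ n, ∫ x, ‖y n x - y m x‖ ∂μ ≤ ε) :
    ∃ z, Integrable z μ ∧ Tendsto (fun n => ∫ x, ‖y n x - z x‖ ∂μ) atTop (𝓝 0) := by
  have hd : ∀ n m, dist ((hy n).toL1 (y n)) ((hy m).toL1 (y m)) = ∫ x, ‖y n x - y m x‖ ∂μ := by
    intro n m
    rw [dist_eq_norm, ← Integrable.toL1_sub, L1.norm_eq_integral_norm]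
    refine integral_congr_ae ?_
    filter_upwards [((hy n).sub (hy m)).coeFn_toL1] with x h
    rw [h, Pi.sub_apply]
  have hcs : CauchySeq (fun n => (hy n).toL1 (y n)) := by
    rw [Metric.cauchySeq_iff']
    intro ε hε
    obtain ⟨N, hN⟩ := hc (ε / 2) (by positivity)
    refine ⟨N, fun n hn => ?_⟩
    rw [dist_comm, hd]
    linarith [hN N le_rfl n hn]
  obtain ⟨z, hz⟩ := cauchySeq_tendsto_of_complete hcs
  have hzi : Integrable z μ := L1.integrable_coeFn z
  refine ⟨z, hzi, ?_⟩
  rw [tendsto_iff_dist_tendsto_zero] at hz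
  refine hz.congr fun n => ?_
  rw [dist_eq_norm, L1.norm_eq_integral_norm]
  refine integral_congr_ae ?_
  filter_upwards [Lp.coeFn_sub ((hy n).toL1 (y n)) z, (hy n).coeFn_toL1] with x h1 h2
  rw [h1, Pi.sub_apply, h2]

variable [InnerProductSpace ℝ E]

/-- A decreasing sequence of nonempty convex sets of uniformly integrable functions has a selection
that converges in `L¹`. -/
theorem exists_selection_tendsto_L1 [MeasurableSpace E] [BorelSpace E] [CompleteSpace E]
    [IsFiniteMeasure μ] {S : ℕ → Set (α → E)} (hanti : Antitone S) (hconv : ∀ n, Convex ℝ (S n))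
    (hne : ∀ n, (S n).Nonempty) (hint : ∀ σ ∈ S 0, Integrable σ μ)
    (hui : ∀ ε > 0, ∃ R, 0 ≤ R ∧ ∀ σ ∈ S 0,
      ∫ x, {s : E | R < ‖s‖}.indicator norm (σ x) ∂μ ≤ ε) :
    ∃ y : ℕ → α → E, (∀ n, y n ∈ S n) ∧ ∃ z, Integrable z μ ∧
      Tendsto (fun n => ∫ x, ‖y n x - z x‖ ∂μ) atTop (𝓝 0) := by
  have h0 : ∀ n, S n ⊆ S 0 := fun n => hanti (Nat.zero_le n)
  set J : (α → E) → ℝ := fun σ => ∫ x, japaneseBracket (σ x) ∂μ with hJ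
  have hJ0 : ∀ σ, 0 ≤ J σ := fun σ => integral_nonneg fun x => japaneseBracket_nonneg _
  obtain ⟨M, hM⟩ : ∃ M, ∀ σ ∈ S 0, J σ ≤ M := by
    obtain ⟨R, hR, h⟩ := hui 1 one_pos
    refine ⟨(1 + R) * μ.real univ + 1, fun σ hσ => ?_⟩
    have hi := integrable_indicator_norm (hint σ hσ) R
    calc J σ ≤ ∫ x, (1 + R) + {s : E | R < ‖s‖}.indicator norm (σ x) ∂μ := by
          refine integral_mono (integrable_japaneseBracket (hint σ hσ))
            ((integrable_const _).add hi) fun x => (japaneseBracket_le _).trans ?_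
          by_cases hx : σ x ∈ {s : E | R < ‖s‖}
          · rw [indicator_of_mem hx]; linarith
          · rw [indicator_of_notMem hx]
            simp only [mem_ofPred_eq, not_lt] at hx
            linarith
      _ ≤ _ := by
        rw [integral_add (integrable_const _) hi, integral_const, smul_eq_mul, mul_comm]
        linarith [h σ hσ]
  -- The infima increase with `n` and are bounded by `M`, so they converge; this limit controls all
  -- gaps.
  set I : ℕ → ℝ := fun n => sInf (J '' S n)
  have hbdd : ∀ n, BddBelow (J '' S n) := fun n => ⟨0, by rintro _ ⟨σ, -, rfl⟩; exact hJ0 σ⟩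
  have hImono : Monotone I := fun n m hnm =>
    csInf_le_csInf (hbdd n) ((hne m).image J) (image_mono (hanti hnm))
  have hIle : ∀ n, ∀ σ ∈ S n, I n ≤ J σ := fun n σ hσ => csInf_le (hbdd n) ⟨σ, hσ, rfl⟩
  have hIbdd : BddAbove (range I) := by
    refine ⟨M, ?_⟩
    rintro _ ⟨n, rfl⟩
    obtain ⟨σ, hσ⟩ := hne n
    exact (hIle n σ hσ).trans (hM σ (h0 n hσ))
  have hIlim := tendsto_atTop_ciSup hImono hIbdd
  set I' := ⨆ n, I n
  have hI' : ∀ n, I n ≤ I' := fun n => le_ciSup hIbdd n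
  have hex : ∀ n : ℕ, ∃ σ ∈ S n, J σ < I n + 1 / ((n : ℝ) + 1) := by
    intro n
    obtain ⟨_, ⟨σ, hσ, rfl⟩, h⟩ := exists_lt_of_csInf_lt ((hne n).image J)
      (lt_add_of_pos_right (I n) (Nat.one_div_pos_of_nat (n := n) (α := ℝ)))
    exact ⟨σ, hσ, h⟩
  choose y hyS hyJ using hex
  have hyi : ∀ n, Integrable (y n) μ := fun n => hint _ (h0 n (hyS n))
  refine ⟨y, hyS, exists_tendsto_L1_of_cauchy hyi fun ε hε => ?_⟩
  obtain ⟨R, hR, hRui⟩ := hui (ε / 16) (by positivity)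
  -- Error budget: `ε / 4` from `δ`, `ε / 2` from the gap, and `2 * ε / 16` from each of the two
  -- tails.
  set δ : ℝ := ε / (4 * (μ.real univ + 1)) with hδ
  have hμ0 : 0 ≤ μ.real univ := measureReal_nonneg
  have hδ0 : 0 < δ := by positivity
  set K := 2 * (1 + R) ^ 3 / δ with hK
  have hK0 : 0 ≤ K := by positivity
  have hlim : Tendsto (fun n : ℕ => K * (I' - I n + 1 / ((n : ℝ) + 1))) atTop (𝓝 0) := by
    have := (((tendsto_const_nhds (x := I')).sub hIlim).add
      (tendsto_one_div_add_atTop_nhds_zero_nat (𝕜 := ℝ))).const_mul K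
    simpa using this
  obtain ⟨N, hN⟩ := eventually_atTop.1 (hlim.eventually (gt_mem_nhds (show 0 < ε / 2 by positivity)))
  refine ⟨N, fun n hn m hm => ?_⟩
  -- As `m ≥ n`, both functions lie in the convex set `S n`, so `J` at their midpoint is at least `I
  -- n`.
  have hmid : (1 / 2 : ℝ) • (y n + y m) ∈ S n := by
    rw [smul_add]
    exact hconv n (hyS n) (hanti hm (hyS m)) (by norm_num) (by norm_num) (by norm_num)
  have jn := integrable_japaneseBracket (hyi n)
  have jm := integrable_japaneseBracket (hyi m)
  have jmid := integrable_japaneseBracket (hint _ (h0 n hmid))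
  have hgi : Integrable (fun x => bracketGap (y n x) (y m x)) μ := ((jn.add jm).div_const 2).sub jmid
  have hgap : ∫ x, bracketGap (y n x) (y m x) ∂μ ≤ I' - I n + 1 / ((n : ℝ) + 1) := by
    have e : ∫ x, bracketGap (y n x) (y m x) ∂μ =
        (J (y n) + J (y m)) / 2 - J ((1 / 2 : ℝ) • (y n + y m)) := by
      simp only [hJ, bracketGap]
      rw [← integral_add jn jm, ← integral_div]
      exact integral_sub ((jn.add jm).div_const 2) jmid
    have h1 := hIle n _ hmid
    have h2 : 1 / ((m : ℝ) + 1) ≤ 1 / ((n : ℝ) + 1) := by gcongr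
    have h3 := hyJ n
    have h4 := hyJ m
    have h5 := hI' n
    have h6 := hI' m
    rw [e]; linarith
  have in1 := integrable_indicator_norm (hyi n) R
  have in2 := integrable_indicator_norm (hyi m) R
  have i1 : Integrable (fun x => δ + K * bracketGap (y n x) (y m x)) μ :=
    (integrable_const δ).add (hgi.const_mul K)
  have i2 : Integrable (fun x => δ + K * bracketGap (y n x) (y m x) +
      2 * {s : E | R < ‖s‖}.indicator norm (y n x)) μ := i1.add (in1.const_mul 2)
  calc ∫ x, ‖y n x - y m x‖ ∂μ
      ≤ ∫ x, δ + K * bracketGap (y n x) (y m x) + 2 * {s : E | R < ‖s‖}.indicator norm (y n x) +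
        2 * {s : E | R < ‖s‖}.indicator norm (y m x) ∂μ :=
        integral_mono ((hyi n).sub (hyi m)).norm (i2.add (in2.const_mul 2)) fun x => norm_sub_le_bracketGap _ _ hR hδ0
    _ = μ.real univ * δ + K * ∫ x, bracketGap (y n x) (y m x) ∂μ +
        2 * ∫ x, {s : E | R < ‖s‖}.indicator norm (y n x) ∂μ +
        2 * ∫ x, {s : E | R < ‖s‖}.indicator norm (y m x) ∂μ := by
      rw [integral_add i2 (in2.const_mul 2), integral_add i1 (in1.const_mul 2),
        integral_add (integrable_const δ) (hgi.const_mul K), integral_const,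
        integral_const_mul, integral_const_mul, integral_const_mul, smul_eq_mul]
    _ ≤ ε := by
      have h1 := hRui _ (h0 n (hyS n))
      have h2 := hRui _ (h0 m (hyS m))
      have h3 := mul_le_mul_of_nonneg_left hgap hK0
      have h4 := hN n hn
      have h5 : μ.real univ * δ ≤ ε / 4 := by
        rw [hδ, mul_div_assoc', div_le_div_iff₀ (by positivity) (by positivity)]
        nlinarith
      linarith

end Selection

/-! ### Compactness of fluxes and lower semicontinuity of the transport cost -/

section Flux

variable {d : ℕ} {Ω Ω' C C' : Set (EuclideanSpace ℝ (Fin d))}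
  {fp fm : Measure (EuclideanSpace ℝ (Fin d))} {H H₁ H₂ : EuclideanSpace ℝ (Fin d) → ℝ≥0∞}
  {σ τ : EuclideanSpace ℝ (Fin d) → EuclideanSpace ℝ (Fin d)}

lemma fluxCost_mono (h : Ω ⊆ Ω') : fluxCost Ω H₁ H₂ C σ ≤ fluxCost Ω' H₁ H₂ C σ :=
  add_le_add (lintegral_mono_set (sdiff_subset_sdiff_left h))
    (lintegral_mono_set (inter_subset_inter_left _ h))

lemma fluxCost_congr_set (h : C =ᵐ[volume] C') :
    fluxCost Ω H₁ H₂ C σ = fluxCost Ω H₁ H₂ C' σ := by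
  unfold fluxCost
  rw [setLIntegral_congr ((ae_eq_refl Ω).diff h), setLIntegral_congr ((ae_eq_refl Ω).inter h)]

lemma transportCost_congr_set (h : C =ᵐ[volume] C') :
    transportCost Ω fp fm H₁ H₂ C = transportCost Ω fp fm H₁ H₂ C' := by
  simp only [transportCost, fluxCost_congr_set h]

/-- An energy bound that does not depend on `C`; this is where the ordering of the two costs enters.
-/
lemma setLIntegral_le_fluxCost (hH : ∀ s, H₁ s ≤ H₂ s) :
    ∫⁻ x in Ω, H₁ (σ x) ≤ fluxCost Ω H₁ H₂ C σ := by
  conv_lhs => rw [← sdiff_union_inter Ω C]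
  exact (lintegral_union_le _ _ _).trans (add_le_add_left (lintegral_mono fun x => hH _) _)

lemma IsCongestionFunction.aemeasurable_comp (hH : IsCongestionFunction H)
    {μ : Measure (EuclideanSpace ℝ (Fin d))} (hσ : AEStronglyMeasurable σ μ) :
    AEMeasurable (fun x => H (σ x)) μ :=
  hH.continuous.measurable.comp_aemeasurable hσ.aemeasurable

lemma IsCongestionFunction.lintegral_combo_le (hH : IsCongestionFunction H)
    {μ : Measure (EuclideanSpace ℝ (Fin d))}
    (hσ : AEStronglyMeasurable σ μ) (hτ : AEStronglyMeasurable τ μ) {a b : ℝ≥0} (hab : a + b = 1) :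
    ∫⁻ x, H ((a • σ + b • τ) x) ∂μ ≤ a * ∫⁻ x, H (σ x) ∂μ + b * ∫⁻ x, H (τ x) ∂μ := by
  rw [← lintegral_const_mul'' _ (hH.aemeasurable_comp hσ),
    ← lintegral_const_mul'' _ (hH.aemeasurable_comp hτ),
    ← lintegral_add_left' ((hH.aemeasurable_comp hσ).const_mul _)]
  exact lintegral_mono fun x =>
    hH.convex.2 (mem_univ (σ x)) (mem_univ (τ x)) (zero_le (a := a)) (zero_le (a := b)) hab

lemma fluxCost_combo_le (hH₁ : IsCongestionFunction H₁) (hH₂ : IsCongestionFunction H₂)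
    (hσ : AEStronglyMeasurable σ (volume.restrict Ω))
    (hτ : AEStronglyMeasurable τ (volume.restrict Ω)) {a b : ℝ≥0} (hab : a + b = 1) :
    fluxCost Ω H₁ H₂ C (a • σ + b • τ) ≤
      a * fluxCost Ω H₁ H₂ C σ + b * fluxCost Ω H₁ H₂ C τ := by
  refine (add_le_add (hH₂.lintegral_combo_le (hσ.mono_measure ?_) (hτ.mono_measure ?_) hab)
    (hH₁.lintegral_combo_le (hσ.mono_measure ?_) (hτ.mono_measure ?_) hab)).trans_eq ?_
  · exact Measure.restrict_mono_set _ sdiff_subset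
  · exact Measure.restrict_mono_set _ sdiff_subset
  · exact Measure.restrict_mono_set _ inter_subset_left
  · exact Measure.restrict_mono_set _ inter_subset_left
  · unfold fluxCost
    ring

lemma fluxCost_le_of_tendsto_ae (hH₁ : IsCongestionFunction H₁) (hH₂ : IsCongestionFunction H₂)
    {y : ℕ → EuclideanSpace ℝ (Fin d) → EuclideanSpace ℝ (Fin d)}
    (hy : ∀ n, AEStronglyMeasurable (y n) (volume.restrict Ω))
    (hlim : ∀ᵐ x ∂volume.restrict Ω, Tendsto (fun n => y n x) atTop (𝓝 (σ x)))
    {T : ℕ → ℝ≥0∞} {K : ℝ≥0∞} (hT : Tendsto T atTop (𝓝 K))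
    (hle : ∀ᶠ n in atTop, fluxCost Ω H₁ H₂ C (y n) ≤ T n) :
    fluxCost Ω H₁ H₂ C σ ≤ K := by
  have fatou : ∀ {H : EuclideanSpace ℝ (Fin d) → ℝ≥0∞} {s : Set (EuclideanSpace ℝ (Fin d))},
      IsCongestionFunction H → s ⊆ Ω →
      ∫⁻ x in s, H (σ x) ≤ ⨆ n, ⨅ i ≥ n, ∫⁻ x in s, H (y i x) := by
    intro H s hH hs
    have hμ := Measure.restrict_mono_set (volume : Measure (EuclideanSpace ℝ (Fin d))) hs
    rw [← liminf_eq_iSup_iInf_of_nat]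
    refine le_trans (lintegral_mono_ae ?_)
      (lintegral_liminf_le' fun n => hH.aemeasurable_comp ((hy n).mono_measure hμ))
    filter_upwards [ae_mono hμ hlim] with x hx
    exact (((hH.continuous.tendsto _).comp hx).liminf_eq).ge
  -- With each liminf written as a supremum of tail infima, a pair of tails `i`, `j` is tested at a
  -- common index beyond both.
  refine (add_le_add (fatou hH₂ sdiff_subset) (fatou hH₁ inter_subset_left)).trans
    (ENNReal.iSup_add_iSup_le fun i j => ge_of_tendsto hT ?_)
  filter_upwards [hle, eventually_ge_atTop i, eventually_ge_atTop j] with n hn hi hj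
  exact (add_le_add (iInf₂_le n hi) (iInf₂_le n hj)).trans hn

/-- Monotone convergence: the sets `Ω \ B n` exhaust `Ω` up to a null set. -/
lemma fluxCost_eq_iSup {B : ℕ → Set (EuclideanSpace ℝ (Fin d))} (hB : Antitone B)
    (hB0 : volume (⋂ n, B n) = 0) :
    fluxCost Ω H₁ H₂ C σ = ⨆ n, fluxCost (Ω \ B n) H₁ H₂ C σ := by
  have hmono : Monotone fun n => Ω \ B n := fun m n h => sdiff_subset_sdiff_right (hB h)
  have key : ∀ (s : ℕ → Set (EuclideanSpace ℝ (Fin d))) (t : Set (EuclideanSpace ℝ (Fin d)))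
      (g : EuclideanSpace ℝ (Fin d) → ℝ≥0∞), Monotone s → (⋃ n, s n) ⊆ t →
      t \ (⋃ n, s n) ⊆ ⋂ n, B n → ∫⁻ x in t, g x = ⨆ n, ∫⁻ x in s n, g x := by
    intro s t g hs h1 h2
    rw [← setLIntegral_iUnion_of_directed _ hs.directed_le]
    refine setLIntegral_congr (EventuallyLE.antisymm ?_ h1.eventuallyLE)
    rw [ae_le_set]
    exact measure_mono_null h2 hB0
  unfold fluxCost
  rw [key (fun n => (Ω \ B n) \ C) _ _ (fun m n h => sdiff_subset_sdiff_left (hmono h)),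
    key (fun n => (Ω \ B n) ∩ C) (Ω ∩ C) _ (fun m n h => inter_subset_inter_left _ (hmono h)),
    ENNReal.iSup_add_iSup_of_monotone]
  · exact fun m n h => lintegral_mono_set (sdiff_subset_sdiff_left (hmono h))
  · exact fun m n h => lintegral_mono_set (inter_subset_inter_left _ (hmono h))
  · exact iUnion_subset fun n => inter_subset_inter_left _ sdiff_subset
  · intro x hx
    simp only [Set.mem_sdiff, mem_iUnion, mem_inter_iff, not_exists, not_and] at hx
    exact mem_iInter.2 fun n => by
      by_contra h
      exact hx.2 n ⟨hx.1.1, h⟩ hx.1.2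
  · exact iUnion_subset fun n => sdiff_subset_sdiff_left sdiff_subset
  · intro x hx
    simp only [Set.mem_sdiff, mem_iUnion, not_exists, not_and, not_not] at hx
    exact mem_iInter.2 fun n => by
      by_contra h
      exact hx.1.2 (hx.2 n ⟨hx.1.1, h⟩)

lemma IsCongestionFunction.exists_norm_le (hH : IsCongestionFunction H) (M : ℝ≥0) :
    ∃ R, 0 ≤ R ∧ ∀ s, R < ‖s‖ → M * ‖s‖ₑ ≤ H s := by
  have h := hH.superlinear.eventually (lt_mem_nhds (ENNReal.coe_lt_top (r := M)))
  obtain ⟨R, -, hR⟩ := hasBasis_cobounded_norm.eventually_iff.1 h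
  exact ⟨max R 0, le_max_right _ _, fun s hs =>
    ENNReal.mul_le_of_le_div (hR ((le_max_left R 0).trans hs.le)).le⟩

/-- De la Vallée-Poussin: beyond `R` one has `|s| ≤ H s / M`, so the tail is at most `T / M`. The `+
1` in the choice of `M` keeps it nonzero. -/
lemma IsCongestionFunction.uniformIntegrable (hH : IsCongestionFunction H)
    {μ : Measure (EuclideanSpace ℝ (Fin d))} {T : ℝ≥0∞} (hT : T < ⊤) {ε : ℝ} (hε : 0 < ε) :
    ∃ R, 0 ≤ R ∧ ∀ σ, Integrable σ μ → ∫⁻ x, H (σ x) ∂μ ≤ T →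
      ∫ x, {s : EuclideanSpace ℝ (Fin d) | R < ‖s‖}.indicator norm (σ x) ∂μ ≤ ε := by
  set M : ℝ≥0 := T.toNNReal / ε.toNNReal + 1 with hM
  obtain ⟨R, hR, h⟩ := hH.exists_norm_le M
  have hM0 : (M : ℝ≥0∞) ≠ 0 := by
    rw [ENNReal.coe_ne_zero]
    positivity
  have hε' : 0 < ε.toNNReal := Real.toNNReal_pos.2 hε
  refine ⟨R, hR, fun σ hσ hσT => ?_⟩
  rw [integral_eq_lintegral_of_nonneg_ae
    (Eventually.of_forall fun x => indicator_nonneg (fun _ _ => norm_nonneg _) _)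
    (integrable_indicator_norm hσ R).aestronglyMeasurable]
  refine ENNReal.toReal_le_of_le_ofReal hε.le ?_
  have hpt : ∀ x, ENNReal.ofReal ({s : EuclideanSpace ℝ (Fin d) | R < ‖s‖}.indicator norm (σ x)) ≤
      (M : ℝ≥0∞)⁻¹ * H (σ x) := by
    intro x
    by_cases hx : σ x ∈ {s : EuclideanSpace ℝ (Fin d) | R < ‖s‖}
    · rw [indicator_of_mem hx, ofReal_norm, mul_comm, ← div_eq_mul_inv,
        ENNReal.le_div_iff_mul_le (Or.inl hM0) (Or.inl ENNReal.coe_ne_top), mul_comm]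
      exact h _ hx
    · simp [indicator_of_notMem hx]
  calc _ ≤ ∫⁻ x, (M : ℝ≥0∞)⁻¹ * H (σ x) ∂μ := lintegral_mono hpt
    _ = (M : ℝ≥0∞)⁻¹ * ∫⁻ x, H (σ x) ∂μ := lintegral_const_mul' _ _ (ENNReal.inv_ne_top.2 hM0)
    _ ≤ (M : ℝ≥0∞)⁻¹ * T := by gcongr
    _ ≤ ENNReal.ofReal ε := by
      rw [mul_comm, ← div_eq_mul_inv, ENNReal.div_le_iff hM0 ENNReal.coe_ne_top,
        ← ENNReal.coe_toNNReal hT.ne, ENNReal.ofReal, ← ENNReal.coe_mul, ENNReal.coe_le_coe, hM,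
        mul_add, mul_div_cancel₀ _ hε'.ne']
      simp

lemma exists_fderiv_bound (hΩ : IsBounded Ω) {φ : EuclideanSpace ℝ (Fin d) → ℝ}
    (hφ : ContDiff ℝ ∞ φ) : ∃ M, ∀ x ∈ Ω, ‖fderiv ℝ φ x‖ ≤ M := by
  obtain ⟨M, hM⟩ := hΩ.isCompact_closure.exists_bound_of_continuousOn
    (hφ.continuous_fderiv (by simp)).continuousOn
  exact ⟨M, fun x hx => hM x (subset_closure hx)⟩

lemma integrableOn_fderiv_apply (hΩ : IsBounded Ω) (hΩm : MeasurableSet Ω)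
    {φ : EuclideanSpace ℝ (Fin d) → ℝ} (hφ : ContDiff ℝ ∞ φ) (hσ : IntegrableOn σ Ω) :
    IntegrableOn (fun x => fderiv ℝ φ x (σ x)) Ω := by
  obtain ⟨M, hM⟩ := exists_fderiv_bound hΩ hφ
  refine (hσ.norm.const_mul M).mono' ?_ ?_
  · exact isBoundedBilinearMap_apply.continuous.comp_aestronglyMeasurable
      ((hφ.continuous_fderiv (by simp)).aestronglyMeasurable.prodMk hσ.aestronglyMeasurable)
  · filter_upwards [ae_restrict_mem hΩm] with x hx
    exact (ContinuousLinearMap.le_opNorm _ _).trans (by gcongr; exact hM x hx)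

lemma convex_admissibleFluxes (hΩ : IsBounded Ω) (hΩm : MeasurableSet Ω) :
    Convex ℝ (admissibleFluxes Ω fp fm) := by
  intro σ hσ τ hτ a b ha hb hab
  refine ⟨(hσ.1.smul a).add (hτ.1.smul b), fun φ hφ => ?_⟩
  have h1 := integrableOn_fderiv_apply hΩ hΩm hφ hσ.1
  have h2 := integrableOn_fderiv_apply hΩ hΩm hφ hτ.1
  simp only [Pi.add_apply, Pi.smul_apply, map_add, map_smul, smul_eq_mul]
  rw [integral_add (h1.const_mul a) (h2.const_mul b), integral_const_mul, integral_const_mul,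
    hσ.2 φ hφ, hτ.2 φ hφ, ← add_mul, hab, one_mul]

/-- The gradient of a smooth test function is bounded on the bounded set `Ω`, so the weak equation
is continuous in `L¹`. -/
lemma mem_admissibleFluxes_of_tendsto (hΩ : IsBounded Ω) (hΩm : MeasurableSet Ω)
    {y : ℕ → EuclideanSpace ℝ (Fin d) → EuclideanSpace ℝ (Fin d)}
    (hy : ∀ n, y n ∈ admissibleFluxes Ω fp fm) (hσ : IntegrableOn σ Ω)
    (hlim : Tendsto (fun n => ∫ x in Ω, ‖y n x - σ x‖) atTop (𝓝 0)) :
    σ ∈ admissibleFluxes Ω fp fm := by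
  refine ⟨hσ, fun φ hφ => ?_⟩
  obtain ⟨M, hM⟩ := exists_fderiv_bound hΩ hφ
  have hσi := integrableOn_fderiv_apply hΩ hΩm hφ hσ
  have hz : Tendsto (fun n => M * ∫ x in Ω, ‖y n x - σ x‖) atTop (𝓝 0) := by
    simpa using hlim.const_mul M
  have h0 : Tendsto (fun n => (∫ x in Ω, fderiv ℝ φ x (y n x)) - ∫ x in Ω, fderiv ℝ φ x (σ x))
      atTop (𝓝 0) := by
    refine squeeze_zero_norm (fun n => ?_) hz
    rw [← integral_sub (integrableOn_fderiv_apply hΩ hΩm hφ (hy n).1) hσi, ← integral_const_mul]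
    refine norm_integral_le_of_norm_le (((hy n).1.sub hσ).norm.const_mul M) ?_
    filter_upwards [ae_restrict_mem hΩm] with x hx
    rw [← map_sub]
    exact (ContinuousLinearMap.le_opNorm _ _).trans (by gcongr; exact hM x hx)
  simp only [fun n => (hy n).2 φ hφ] at h0
  exact (sub_eq_zero.1 (tendsto_nhds_unique tendsto_const_nhds h0)).symm

/-- Lower semicontinuity of the cost and compactness of fluxes, along converging sets. -/
theorem exists_flux_fluxCost_le_limsup (hΩ : IsBounded Ω) (hΩm : MeasurableSet Ω)
    (hH₁ : IsCongestionFunction H₁) (hH₂ : IsCongestionFunction H₂) (hH : ∀ s, H₁ s ≤ H₂ s)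
    {D B : ℕ → Set (EuclideanSpace ℝ (Fin d))} (hB : Antitone B) (hB0 : volume (⋂ n, B n) = 0)
    (hD : ∀ n, symmDiff (D n) C ⊆ B n)
    {s : ℕ → EuclideanSpace ℝ (Fin d) → EuclideanSpace ℝ (Fin d)}
    (hs : ∀ n, s n ∈ admissibleFluxes Ω fp fm)
    {M : ℝ≥0∞} (hM : M < ⊤) (hsM : ∀ n, fluxCost Ω H₁ H₂ (D n) (s n) ≤ M) :
    ∃ σ ∈ admissibleFluxes Ω fp fm,
      fluxCost Ω H₁ H₂ C σ ≤ limsup (fun n => fluxCost Ω H₁ H₂ (D n) (s n)) atTop := by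
  have : IsFiniteMeasure (volume.restrict Ω) := ⟨by
    rw [Measure.restrict_apply_univ]; exact hΩ.measure_lt_top⟩
  set T : ℕ → ℝ≥0∞ := fun n => ⨆ i ≥ n, fluxCost Ω H₁ H₂ (D i) (s i) with hT
  have hTanti : Antitone T := fun m n h => biSup_mono fun i hi => h.trans hi
  have hTlim : Tendsto T atTop (𝓝 (limsup (fun n => fluxCost Ω H₁ H₂ (D n) (s n)) atTop)) := by
    rw [limsup_eq_iInf_iSup_of_nat]
    exact tendsto_atTop_iInf hTanti
  -- Removing `B n` allows the fixed set `C` in place of `D n`, which makes the sets nested. The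
  -- last condition supplies the uniform integrability on all of `Ω`, including `B n`.
  set S : ℕ → Set (EuclideanSpace ℝ (Fin d) → EuclideanSpace ℝ (Fin d)) := fun n =>
    {σ | σ ∈ admissibleFluxes Ω fp fm ∧ fluxCost (Ω \ B n) H₁ H₂ C σ ≤ T n ∧
      ∫⁻ x in Ω, H₁ (σ x) ≤ M} with hS
  have hSanti : Antitone S := fun m n h σ hσ =>
    ⟨hσ.1, (fluxCost_mono (sdiff_subset_sdiff_right (hB h))).trans (hσ.2.1.trans (hTanti h)), hσ.2.2⟩
  have hcombo : ∀ {a b : ℝ≥0}, a + b = 1 → ∀ {u v w : ℝ≥0∞}, u ≤ w → v ≤ w →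
      a * u + b * v ≤ w := by
    intro a b hab u v w hu hv
    calc (a : ℝ≥0∞) * u + b * v ≤ a * w + b * w := by gcongr
      _ = w := by rw [← add_mul, ← ENNReal.coe_add, hab, ENNReal.coe_one, one_mul]
  have hSconv : ∀ n, Convex ℝ (S n) := by
    intro n σ hσ τ hτ a b ha hb hab
    refine ⟨convex_admissibleFluxes hΩ hΩm hσ.1 hτ.1 ha hb hab, ?_⟩
    lift a to ℝ≥0 using ha
    lift b to ℝ≥0 using hb
    have hab' : a + b = 1 := by exact_mod_cast hab
    have h1 := hσ.1.1.aestronglyMeasurable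
    have h2 := hτ.1.1.aestronglyMeasurable
    have hr := Measure.restrict_mono_set (volume : Measure (EuclideanSpace ℝ (Fin d)))
      (sdiff_subset : Ω \ B n ⊆ Ω)
    exact ⟨(fluxCost_combo_le hH₁ hH₂ (h1.mono_measure hr) (h2.mono_measure hr) hab').trans
      (hcombo hab' hσ.2.1 hτ.2.1),
      (hH₁.lintegral_combo_le h1 h2 hab').trans (hcombo hab' hσ.2.2 hτ.2.2)⟩
  have hSne : ∀ n, (S n).Nonempty := by
    refine fun n => ⟨s n, hs n, ?_, (setLIntegral_le_fluxCost hH).trans (hsM n)⟩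
    have hCD : ∀ x ∉ B n, (x ∈ C ↔ x ∈ D n) := by
      intro x hx
      have := fun h => hx (hD n h)
      rw [mem_symmDiff] at this
      tauto
    have e1 : (Ω \ B n) \ C = (Ω \ B n) \ D n := by
      ext x; simp only [Set.mem_sdiff]; have := hCD x; tauto
    have e2 : (Ω \ B n) ∩ C = (Ω \ B n) ∩ D n := by
      ext x; simp only [Set.mem_sdiff, mem_inter_iff]; have := hCD x; tauto
    calc fluxCost (Ω \ B n) H₁ H₂ C (s n) = fluxCost (Ω \ B n) H₁ H₂ (D n) (s n) := by
          unfold fluxCost; rw [e1, e2]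
      _ ≤ fluxCost Ω H₁ H₂ (D n) (s n) := fluxCost_mono sdiff_subset
      _ ≤ T n := le_iSup₂_of_le n le_rfl le_rfl
  obtain ⟨y, hyS, z, hz, hyz⟩ := exists_selection_tendsto_L1 (μ := volume.restrict Ω) hSanti hSconv
    hSne (fun σ hσ => hσ.1.1) (fun ε hε => by
      obtain ⟨R, hR, h⟩ := hH₁.uniformIntegrable (μ := volume.restrict Ω) hM hε
      exact ⟨R, hR, fun σ hσ => h σ hσ.1.1 hσ.2.2⟩)
  refine ⟨z, mem_admissibleFluxes_of_tendsto hΩ hΩm (fun n => (hyS n).1) hz hyz, ?_⟩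
  have hmeas : TendstoInMeasure (volume.restrict Ω) y atTop z := by
    refine tendstoInMeasure_of_tendsto_eLpNorm one_ne_zero
      (fun n => (hyS n).1.1.aestronglyMeasurable) hz.aestronglyMeasurable ?_
    have := ENNReal.tendsto_ofReal hyz
    rw [ENNReal.ofReal_zero] at this
    refine this.congr fun n => ?_
    rw [eLpNorm_one_eq_lintegral_enorm]
    exact ofReal_integral_norm_eq_lintegral_enorm ((hyS n).1.1.sub hz)
  obtain ⟨ns, hns, hae⟩ := hmeas.exists_seq_tendsto_ae
  rw [fluxCost_eq_iSup hB hB0]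
  -- With `m` fixed, the later terms of the selection satisfy their bound off a smaller set than `B
  -- m`, so Fatou applies on `Ω \ B m`.
  refine iSup_le fun m => ?_
  have hr := Measure.restrict_mono_set (volume : Measure (EuclideanSpace ℝ (Fin d)))
    (sdiff_subset : Ω \ B m ⊆ Ω)
  refine fluxCost_le_of_tendsto_ae hH₁ hH₂
    (fun n => (hyS (ns n)).1.1.aestronglyMeasurable.mono_measure hr) (ae_mono hr hae)
    (hTlim.comp hns.tendsto_atTop) ?_
  filter_upwards [hns.tendsto_atTop.eventually (eventually_ge_atTop m)] with n hn
  exact (fluxCost_mono (sdiff_subset_sdiff_right (hB hn))).trans (hyS (ns n)).2.1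

/-- The infimum in the definition of the transport cost is attained. -/
theorem exists_flux_fluxCost_eq_transportCost (hΩ : IsBounded Ω) (hΩm : MeasurableSet Ω)
    (hH₁ : IsCongestionFunction H₁) (hH₂ : IsCongestionFunction H₂) (hH : ∀ s, H₁ s ≤ H₂ s)
    (hC : transportCost Ω fp fm H₁ H₂ C < ⊤) :
    ∃ σ ∈ admissibleFluxes Ω fp fm, fluxCost Ω H₁ H₂ C σ = transportCost Ω fp fm H₁ H₂ C := by
  set F := transportCost Ω fp fm H₁ H₂ C with hF
  have hex : ∀ n : ℕ, ∃ σ ∈ admissibleFluxes Ω fp fm,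
      fluxCost Ω H₁ H₂ C σ < F + ((n : ℝ≥0∞) + 1)⁻¹ := by
    intro n
    have : F < F + ((n : ℝ≥0∞) + 1)⁻¹ := ENNReal.lt_add_right hC.ne (by simp)
    nth_rw 1 [hF] at this
    simpa only [transportCost, iInf_lt_iff, exists_prop] using this
  choose s hs hsF using hex
  have hlim : Tendsto (fun n : ℕ => F + ((n : ℝ≥0∞) + 1)⁻¹) atTop (𝓝 F) := by
    have : Tendsto (fun n : ℕ => (((n + 1 : ℕ) : ℝ≥0∞))⁻¹) atTop (𝓝 0) :=
      ENNReal.tendsto_inv_nat_nhds_zero.comp (tendsto_add_atTop_nat 1)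
    simpa using this.const_add F
  obtain ⟨σ, hσ, h⟩ := exists_flux_fluxCost_le_limsup (C := C) (D := fun _ => C) (B := fun _ => ∅)
    hΩ hΩm hH₁ hH₂ hH antitone_const (by rw [iInter_const, measure_empty])
    (fun n => by rw [symmDiff_self]; exact subset_rfl) hs
    (ENNReal.add_lt_top.2 ⟨hC, ENNReal.one_lt_top⟩)
    (fun n => (hsF n).le.trans (add_le_add_right (ENNReal.inv_le_one.2 (by simp)) _))
  refine ⟨σ, hσ, le_antisymm (h.trans ?_) (iInf₂_le σ hσ)⟩
  rw [← hlim.limsup_eq]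
  exact limsup_le_limsup (Eventually.of_forall fun n => (hsF n).le)

/-- Lower semicontinuity of the transport cost. -/
theorem transportCost_le_limsup (hΩ : IsBounded Ω) (hΩm : MeasurableSet Ω)
    (hH₁ : IsCongestionFunction H₁) (hH₂ : IsCongestionFunction H₂) (hH : ∀ s, H₁ s ≤ H₂ s)
    {D B : ℕ → Set (EuclideanSpace ℝ (Fin d))} (hB : Antitone B) (hB0 : volume (⋂ n, B n) = 0)
    (hD : ∀ n, symmDiff (D n) C ⊆ B n) {M : ℝ≥0∞} (hM : M < ⊤)
    (hDM : ∀ n, transportCost Ω fp fm H₁ H₂ (D n) ≤ M) :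
    transportCost Ω fp fm H₁ H₂ C ≤
      limsup (fun n => transportCost Ω fp fm H₁ H₂ (D n)) atTop := by
  choose s hs hsF using fun n => exists_flux_fluxCost_eq_transportCost hΩ hΩm hH₁ hH₂ hH
    ((hDM n).trans_lt hM)
  obtain ⟨σ, hσ, h⟩ := exists_flux_fluxCost_le_limsup hΩ hΩm hH₁ hH₂ hH hB hB0 hD hs hM
    (fun n => (hsF n).trans_le (hDM n))
  simp only [hsF] at h
  exact (iInf₂_le σ hσ).trans h

end Flux

/-! ### Lower semicontinuity of the perimeter and the translation estimate -/

section Perimeter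

variable {d : ℕ} {C C' : Set (EuclideanSpace ℝ (Fin d))}

lemma perimeter_congr (h : C =ᵐ[volume] C') : perimeter C = perimeter C' := by
  simp only [perimeter, setIntegral_congr_set h]

lemma continuous_divergence {ψ : EuclideanSpace ℝ (Fin d) → EuclideanSpace ℝ (Fin d)}
    (hψ : ContDiff ℝ 1 ψ) : Continuous (divergence ψ) := by
  have h := hψ.continuous_fderiv one_ne_zero
  unfold divergence
  fun_prop

lemma hasCompactSupport_divergence {ψ : EuclideanSpace ℝ (Fin d) → EuclideanSpace ℝ (Fin d)}
    (hψ : HasCompactSupport ψ) : HasCompactSupport (divergence ψ) :=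
  (hψ.fderiv ℝ).comp_left
    (g := fun T : EuclideanSpace ℝ (Fin d) →L[ℝ] EuclideanSpace ℝ (Fin d) =>
      ∑ i : Fin d, T (EuclideanSpace.single i 1) i) (by simp)

lemma divergence_const_smul {ψ : EuclideanSpace ℝ (Fin d) → EuclideanSpace ℝ (Fin d)}
    (hψ : ContDiff ℝ 1 ψ) (c : ℝ) (x : EuclideanSpace ℝ (Fin d)) :
    divergence (c • ψ) x = c * divergence ψ x := by
  simp only [divergence, fderiv_const_smul (hψ.differentiable one_ne_zero x),
    Finset.mul_sum]
  rfl

lemma divergence_smul_const {f : EuclideanSpace ℝ (Fin d) → ℝ} (hf : ContDiff ℝ 1 f)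
    (v x : EuclideanSpace ℝ (Fin d)) : divergence (fun y => f y • v) x = fderiv ℝ f x v := by
  have hfd : HasFDerivAt (fun y => f y • v) ((fderiv ℝ f x).smulRight v) x :=
    (hf.differentiable one_ne_zero x).hasFDerivAt.smul_const v
  have hv : v = ∑ i, v i • EuclideanSpace.single i (1 : ℝ) := by
    ext j
    simp [Finset.sum_apply, Pi.single_apply]
  simp only [divergence, hfd.fderiv]
  conv_rhs => rw [hv, map_sum]
  simp [mul_comm]

lemma setIntegral_divergence_le (hC : perimeter C ≠ ⊤)
    {ψ : EuclideanSpace ℝ (Fin d) → EuclideanSpace ℝ (Fin d)} (hψ : ContDiff ℝ 1 ψ)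
    (hψc : HasCompactSupport ψ) {M : ℝ} (hM : 0 < M) (hψM : ∀ x, ‖ψ x‖ ≤ M) :
    ∫ x in C, divergence ψ x ≤ M * (perimeter C).toReal := by
  have h1 : ENNReal.ofReal (∫ x in C, divergence (M⁻¹ • ψ) x) ≤ perimeter C := by
    refine le_iSup_of_le (M⁻¹ • ψ) (le_iSup_of_le (contDiff_const.smul hψ) (le_iSup_of_le ?_
      (le_iSup_of_le (fun x => ?_) le_rfl)))
    · exact hψc.comp_left (g := fun v => M⁻¹ • v) (smul_zero _)
    · rw [Pi.smul_apply, norm_smul, norm_inv, Real.norm_of_nonneg hM.le,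
        inv_mul_le_one₀ hM]
      exact hψM x
  have h2 := (ENNReal.ofReal_le_iff_le_toReal hC).1 h1
  simp only [divergence_const_smul hψ, integral_const_mul] at h2
  rwa [inv_mul_le_iff₀ hM] at h2

/-- Dominated convergence: almost every point leaves `B m` for some `m`, after which its membership
in `D n` is that in `C`. -/
lemma tendsto_setIntegral_of_symmDiff {f : EuclideanSpace ℝ (Fin d) → ℝ} (hf : Integrable f)
    {D B : ℕ → Set (EuclideanSpace ℝ (Fin d))} (hDm : ∀ n, MeasurableSet (D n))
    (hC : MeasurableSet C) (hB : Antitone B) (hB0 : volume (⋂ n, B n) = 0)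
    (hD : ∀ n, symmDiff (D n) C ⊆ B n) :
    Tendsto (fun n => ∫ x in D n, f x) atTop (𝓝 (∫ x in C, f x)) := by
  simp only [← integral_indicator (hDm _), ← integral_indicator hC]
  refine tendsto_integral_of_dominated_convergence (fun x => ‖f x‖)
    (fun n => (hf.indicator (hDm n)).aestronglyMeasurable) hf.norm
    (fun n => Eventually.of_forall fun x => norm_indicator_le_norm_self _ _) ?_
  filter_upwards [measure_eq_zero_iff_ae_notMem.1 hB0] with x hx
  obtain ⟨m, hm⟩ : ∃ m, x ∉ B m := by simpa using hx
  refine tendsto_const_nhds.congr' ?_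
  filter_upwards [eventually_ge_atTop m] with n hn
  have hxn : x ∉ symmDiff (D n) C := fun h => hm (hB hn (hD n h))
  rw [mem_symmDiff] at hxn
  by_cases h : x ∈ C
  · have h' : x ∈ D n := by tauto
    rw [indicator_of_mem h, indicator_of_mem h']
  · have h' : x ∉ D n := by tauto
    rw [indicator_of_notMem h, indicator_of_notMem h']

/-- Lower semicontinuity of the perimeter. -/
theorem perimeter_le_of_tendsto
    {D B : ℕ → Set (EuclideanSpace ℝ (Fin d))} (hDm : ∀ n, MeasurableSet (D n))
    (hC : MeasurableSet C) (hB : Antitone B) (hB0 : volume (⋂ n, B n) = 0)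
    (hD : ∀ n, symmDiff (D n) C ⊆ B n) {p : ℝ≥0∞}
    (hp : Tendsto (fun n => perimeter (D n)) atTop (𝓝 p)) : perimeter C ≤ p := by
  refine iSup_le fun ψ => iSup_le fun hψ => iSup_le fun hψc => iSup_le fun hψ1 => ?_
  have hi : Integrable (divergence ψ) :=
    (continuous_divergence hψ).integrable_of_hasCompactSupport (hasCompactSupport_divergence hψc)
  refine le_of_tendsto_of_tendsto'
    (ENNReal.tendsto_ofReal (tendsto_setIntegral_of_symmDiff hi hDm hC hB hB0 hD)) hp fun n => ?_
  exact le_iSup_of_le ψ (le_iSup_of_le hψ (le_iSup_of_le hψc (le_iSup_of_le hψ1 le_rfl)))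

lemma measureReal_sub_le_setIntegral {S K : Set (EuclideanSpace ℝ (Fin d))}
    (hS : volume S ≠ ⊤) (hK : MeasurableSet K) (hKS : K ⊆ S) {δ : ℝ}
    (hδ : volume.real (S \ K) ≤ δ) {φ : EuclideanSpace ℝ (Fin d) → ℝ} (hφ : Continuous φ)
    (hφ1 : ∀ x, |φ x| ≤ 1) (hφK : ∀ x ∈ K, φ x = 1) :
    volume.real S - 2 * δ ≤ ∫ x in S, φ x := by
  have hfin : IsFiniteMeasure (volume.restrict S) := ⟨by
    rw [Measure.restrict_apply_univ]; exact hS.lt_top⟩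
  have hi : IntegrableOn φ S :=
    (integrable_const (1 : ℝ)).mono' hφ.aestronglyMeasurable (Eventually.of_forall hφ1)
  have hSK : volume (S \ K) ≠ ⊤ := ne_top_of_le_ne_top hS (measure_mono sdiff_subset)
  have h1 : ∫ x in S, φ x = (∫ x in S \ K, φ x) + ∫ x in K, φ x := by
    have := setIntegral_sdiff hK hi hKS
    linarith
  have h2 : ∫ x in K, φ x = volume.real K := by
    rw [setIntegral_congr_fun hK hφK, setIntegral_const, smul_eq_mul, mul_one]
  have h3 : volume.real K = volume.real S - volume.real (S \ K) := by
    rw [measureReal_sdiff hKS hK hS]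
    ring
  have h4 : ‖∫ x in S \ K, φ x‖ ≤ 1 * volume.real (S \ K) :=
    norm_setIntegral_le_of_norm_le_const hSK.lt_top fun x _ => hφ1 x
  have h5 := (abs_le.1 h4).1
  rw [h1, h2, h3]
  linarith

lemma exists_contDiff_eq_one_eq_zero {K K' : Set (EuclideanSpace ℝ (Fin d))} (hK : IsCompact K)
    (hK' : IsCompact K') (hd : Disjoint K K') : ∃ f : EuclideanSpace ℝ (Fin d) → ℝ,
      ContDiff ℝ 1 f ∧ HasCompactSupport f ∧ (∀ x, f x ∈ Icc (0 : ℝ) 1) ∧ (∀ x ∈ K, f x = 1) ∧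
        ∀ x ∈ K', f x = 0 := by
  obtain ⟨R, hR⟩ := hK.isBounded.subset_ball 0
  obtain ⟨f, hf, hr, hsupp, h1⟩ := exists_contMDiff_support_eq_eq_one_iff
    (modelWithCornersSelf ℝ (EuclideanSpace ℝ (Fin d))) (n := 1)
    (Metric.isOpen_ball.inter hK'.isClosed.isOpen_compl) hK.isClosed
    (subset_inter hR hd.subset_compl_right)
  refine ⟨f, hf.contDiff, HasCompactSupport.of_support_subset_isCompact
    (isCompact_closedBall 0 R) ?_, fun x => hr ⟨x, rfl⟩, fun x hx => (h1 x).1 hx, fun x hx => ?_⟩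
  · rw [hsupp]
    exact inter_subset_left.trans Metric.ball_subset_closedBall
  · rw [← Function.notMem_support, hsupp]
    exact fun h => h.2 hx

/-- Duality for the `L¹` norm of the difference of two indicators. Its sign is approximated by `f -
g`, equal to `1` and `-1` on compact subsets of `A \ A'` and `A' \ A`; missing measure `ε / 4` on
each side costs at most `2 * (ε / 4)`. -/
lemma volume_symmDiff_le_of_forall_setIntegral_sub_le {A A' : Set (EuclideanSpace ℝ (Fin d))}
    (hA : MeasurableSet A) (hA' : MeasurableSet A') (hAf : volume A ≠ ⊤) (hAf' : volume A' ≠ ⊤)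
    {L : ℝ} (h : ∀ φ : EuclideanSpace ℝ (Fin d) → ℝ, ContDiff ℝ 1 φ → HasCompactSupport φ →
      (∀ x, |φ x| ≤ 1) → (∫ x in A, φ x) - ∫ x in A', φ x ≤ L) :
    volume (symmDiff A A') ≤ ENNReal.ofReal L := by
  have f1 : volume (A \ A') ≠ ⊤ := ne_top_of_le_ne_top hAf (measure_mono sdiff_subset)
  have f2 : volume (A' \ A) ≠ ⊤ := ne_top_of_le_ne_top hAf' (measure_mono sdiff_subset)
  have key : volume.real (A \ A') + volume.real (A' \ A) ≤ L := by
    refine le_of_forall_pos_le_add fun ε hε => ?_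
    have hε4 : ENNReal.ofReal (ε / 4) ≠ 0 := (ENNReal.ofReal_pos.2 (by positivity)).ne'
    obtain ⟨K, hKS, hK, hKε⟩ := (hA.diff hA').exists_isCompact_sdiff_lt f1 hε4
    obtain ⟨K', hKS', hK', hKε'⟩ := (hA'.diff hA).exists_isCompact_sdiff_lt f2 hε4
    have hd : Disjoint K K' := disjoint_sdiff_sdiff.mono hKS hKS'
    obtain ⟨f, fd, fc, fr, fK, fK'⟩ := exists_contDiff_eq_one_eq_zero hK hK' hd
    obtain ⟨g, gd, gc, gr, gK, gK'⟩ := exists_contDiff_eq_one_eq_zero hK' hK hd.symm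
    have hφ : ContDiff ℝ 1 (f - g) := fd.sub gd
    have hφ1 : ∀ x, |(f - g) x| ≤ 1 := fun x => by
      rw [Pi.sub_apply, abs_le]
      constructor <;> linarith [(fr x).1, (fr x).2, (gr x).1, (gr x).2]
    have hφc : HasCompactSupport (f - g) := by
      rw [sub_eq_add_neg]
      exact fc.add (gc.comp_left (g := fun y => -y) neg_zero)
    have hi : Integrable (f - g) := hφ.continuous.integrable_of_hasCompactSupport hφc
    have i1 := measureReal_sub_le_setIntegral f1 hK.measurableSet hKS
      (ENNReal.toReal_le_of_le_ofReal (by positivity) hKε.le) hφ.continuous hφ1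
      (fun x hx => by simp [fK x hx, gK' x hx])
    have i2 := measureReal_sub_le_setIntegral f2 hK'.measurableSet hKS'
      (ENNReal.toReal_le_of_le_ofReal (by positivity) hKε'.le) (φ := -(f - g)) hφ.continuous.neg
      (fun x => by rw [Pi.neg_apply, abs_neg]; exact hφ1 x)
      (fun x hx => by simp [fK' x hx, gK x hx])
    have h0 := h _ hφ hφc hφ1
    -- The integrals over `A ∩ A'` cancel.
    rw [← integral_inter_add_sdiff hA' hi.integrableOn (s := A),
      ← integral_inter_add_sdiff hA hi.integrableOn (s := A'), inter_comm A' A] at h0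
    simp only [Pi.neg_apply, integral_neg] at i2
    linarith
  have hs : volume (symmDiff A A') ≤ volume (A \ A') + volume (A' \ A) := measure_union_le _ _
  refine hs.trans ?_
  rw [← ofReal_measureReal f1, ← ofReal_measureReal f2,
    ← ENNReal.ofReal_add measureReal_nonneg measureReal_nonneg]
  exact ENNReal.ofReal_le_ofReal key

/-- The derivative of `t ↦ ∫_C φ (x - t • h)` is the integral over `C` of the divergence of the
field `-φ (x - t • h) • h`, whose norm is at most `‖h‖`; the mean value inequality on `[0, 1]`
concludes. -/
lemma setIntegral_translate_sub_le (hC : perimeter C ≠ ⊤) (hCf : volume C ≠ ⊤)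
    {φ : EuclideanSpace ℝ (Fin d) → ℝ} (hφ : ContDiff ℝ 1 φ) (hφc : HasCompactSupport φ)
    (hφ1 : ∀ x, |φ x| ≤ 1) {h : EuclideanSpace ℝ (Fin d)} (hh : h ≠ 0) :
    (∫ x in C, φ (x - h)) - ∫ x in C, φ x ≤ ‖h‖ * (perimeter C).toReal := by
  have hfin : IsFiniteMeasure (volume.restrict C) := ⟨by
    rw [Measure.restrict_apply_univ]; exact hCf.lt_top⟩
  have hder : ∀ (t : ℝ) (x : EuclideanSpace ℝ (Fin d)),
      HasDerivAt (fun t : ℝ => φ (x - t • h)) (fderiv ℝ φ (x - t • h) (-h)) t := by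
    intro t x
    have h1 : HasDerivAt (fun t : ℝ => x - t • h) (-h) t := by
      simpa using ((hasDerivAt_id t).smul_const h).const_sub x
    exact (hφ.differentiable one_ne_zero _).hasFDerivAt.comp_hasDerivAt t h1
  have hfc := hφ.continuous_fderiv one_ne_zero
  obtain ⟨M, hM⟩ := hfc.bounded_above_of_compact_support (hφc.fderiv ℝ)
  have hG : ∀ t : ℝ, HasDerivAt (fun t : ℝ => ∫ x in C, φ (x - t • h))
      (∫ x in C, fderiv ℝ φ (x - t • h) (-h)) t := by
    intro t
    have hc : ∀ t : ℝ, Continuous fun x => φ (x - t • h) := fun t =>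
      hφ.continuous.comp (by fun_prop)
    refine (hasDerivAt_integral_of_dominated_loc_of_deriv_le (μ := volume.restrict C)
      (F := fun t x => φ (x - t • h)) (F' := fun t x => fderiv ℝ φ (x - t • h) (-h))
      (bound := fun _ => M * ‖h‖) (s := univ) univ_mem
      (Eventually.of_forall fun t => (hc t).aestronglyMeasurable)
      ((integrable_const (1 : ℝ)).mono' (hc t).aestronglyMeasurable
        (Eventually.of_forall fun x => hφ1 _)) ?_ ?_ (integrable_const _) ?_).2
    · exact ((hfc.comp (continuous_id.sub continuous_const)).clm_apply
        continuous_const).aestronglyMeasurable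
    · refine Eventually.of_forall fun x t _ => ?_
      rw [map_neg, norm_neg]
      exact (ContinuousLinearMap.le_opNorm _ _).trans (by gcongr; exact hM _)
    · exact Eventually.of_forall fun x t _ => hder t x
  have hle : ∀ t : ℝ, deriv (fun t : ℝ => ∫ x in C, φ (x - t • h)) t ≤
      ‖h‖ * (perimeter C).toReal := by
    intro t
    rw [(hG t).deriv]
    have hφt : ContDiff ℝ 1 fun x => φ (x - t • h) := hφ.comp (by fun_prop)
    have hct : HasCompactSupport fun x => φ (x - t • h) :=
      hφc.comp_homeomorph (Homeomorph.subRight (t • h))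
    have e : ∀ x, fderiv ℝ φ (x - t • h) (-h) =
        divergence (fun y => φ (y - t • h) • (-h)) x := by
      intro x
      rw [divergence_smul_const hφt, fderiv_comp_sub]
    simp only [e]
    refine setIntegral_divergence_le hC (hφt.smul contDiff_const) hct.smul_right
      (norm_pos_iff.2 hh) fun x => ?_
    change ‖φ (x - t • h) • (-h)‖ ≤ ‖h‖
    rw [norm_smul, norm_neg]
    exact mul_le_of_le_one_left (norm_nonneg _) (hφ1 _)
  simpa using image_sub_le_mul_sub_of_deriv_le
    (fun t => (hG t).differentiableAt) hle zero_le_one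

/-- Translation estimate for sets of finite perimeter. -/
theorem volume_symmDiff_preimage_add_le (hCm : MeasurableSet C) (hCf : volume C ≠ ⊤)
    (hC : perimeter C ≠ ⊤) (h : EuclideanSpace ℝ (Fin d)) :
    volume (symmDiff ((fun x => x + h) ⁻¹' C) C) ≤
      ENNReal.ofReal (‖h‖ * (perimeter C).toReal) := by
  rcases eq_or_ne h 0 with rfl | hh
  · simp
  have hmp := measurePreserving_add_right (volume : Measure (EuclideanSpace ℝ (Fin d))) h
  refine volume_symmDiff_le_of_forall_setIntegral_sub_le (hmp.measurable hCm) hCm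
    (by rwa [hmp.measure_preimage hCm.nullMeasurableSet]) hCf fun φ hφ hφc hφ1 => ?_
  have := hmp.setIntegral_preimage_emb (measurableEmbedding_addRight h) (fun x => φ (x - h)) C
  simp only [add_sub_cancel_right] at this
  rw [this]
  exact setIntegral_translate_sub_le hC hCf hφ hφc hφ1 hh

end Perimeter

/-! ### Compactness of sets of bounded perimeter -/

section Compactness

variable {d : ℕ} {C C' : Set (EuclideanSpace ℝ (Fin d))}

/-- The pairs of points at distance less than `ε` that are separated by `C`. -/
def separatedPairs (C : Set (EuclideanSpace ℝ (Fin d))) (ε : ℝ) :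
    Set (EuclideanSpace ℝ (Fin d) × EuclideanSpace ℝ (Fin d)) :=
  {p | dist p.2 p.1 < ε} ∩ symmDiff (Prod.fst ⁻¹' C) (Prod.snd ⁻¹' C)

lemma measurableSet_separatedPairs (hC : MeasurableSet C) (ε : ℝ) :
    MeasurableSet (separatedPairs C ε) :=
  (measurableSet_lt (by fun_prop) measurable_const).inter
    ((measurable_fst hC).symmDiff (measurable_snd hC))

lemma mem_separatedPairs {ε : ℝ} {x y : EuclideanSpace ℝ (Fin d)} :
    y ∈ Prod.mk x ⁻¹' separatedPairs C ε ↔ y ∈ Metric.ball x ε ∧ ¬ (x ∈ C ↔ y ∈ C) := by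
  simp only [separatedPairs, mem_preimage, mem_inter_iff, mem_ofPred_eq, mem_symmDiff,
    Metric.mem_ball]
  tauto

/-- In the coordinates `(x, y - x)`, Fubini makes the slice at a fixed difference `h` a subset of
the symmetric difference of `C` and a translate, to which the translation estimate applies with `‖h‖
< ε`. -/
lemma volume_separatedPairs_le (hCm : MeasurableSet C) (hCf : volume C ≠ ⊤)
    (hC : perimeter C ≠ ⊤) (ε : ℝ) :
    ∫⁻ x, volume (Prod.mk x ⁻¹' separatedPairs C ε) ≤
      volume (Metric.ball (0 : EuclideanSpace ℝ (Fin d)) ε) *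
        ENNReal.ofReal (ε * (perimeter C).toReal) := by
  set T : Set (EuclideanSpace ℝ (Fin d) × EuclideanSpace ℝ (Fin d)) :=
    (fun p => (p.1, p.1 + p.2)) ⁻¹' separatedPairs C ε with hT
  have hTm : MeasurableSet T := (by fun_prop : Measurable
    fun p : EuclideanSpace ℝ (Fin d) × EuclideanSpace ℝ (Fin d) => (p.1, p.1 + p.2))
      (measurableSet_separatedPairs hCm ε)
  have h1 : ∀ x, volume (Prod.mk x ⁻¹' separatedPairs C ε) = volume (Prod.mk x ⁻¹' T) := fun x =>
    (measure_preimage_add volume x _).symm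
  simp only [h1]
  rw [← Measure.prod_apply hTm, Measure.prod_apply_symm hTm, mul_comm,
    ← lintegral_indicator_const measurableSet_ball]
  refine lintegral_mono fun h => ?_
  by_cases hh : h ∈ Metric.ball (0 : EuclideanSpace ℝ (Fin d)) ε
  · rw [indicator_of_mem hh]
    have hsub : (fun x => (x, h)) ⁻¹' T ⊆ symmDiff ((fun x => x + h) ⁻¹' C) C := by
      intro x hx
      have := hx.2
      simp only [mem_symmDiff, mem_preimage] at this ⊢
      tauto
    refine (measure_mono hsub).trans ((volume_symmDiff_preimage_add_le hCm hCf hC h).trans ?_)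
    have := (mem_ball_zero_iff.1 hh).le
    gcongr
  · have : (fun x => (x, h)) ⁻¹' T = ∅ := by
      refine eq_empty_of_forall_notMem fun x hx => hh ?_
      have := hx.1
      simpa using this
    simp [this]

/-- The part of the ball outside `C` is separated from `x` by `C`, and the part inside `C'` by `C'`.
Split the ball along `C` and compare `C ∩ ball` with `C' ∩ ball`. -/
lemma volume_ball_le_of_mem_diff {ε : ℝ} {x : EuclideanSpace ℝ (Fin d)} (hC : MeasurableSet C)
    (hx : x ∈ C) (hx' : x ∉ C') :
    volume (Metric.ball (0 : EuclideanSpace ℝ (Fin d)) ε) ≤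
      volume (Prod.mk x ⁻¹' separatedPairs C ε) + volume (Prod.mk x ⁻¹' separatedPairs C' ε) +
        (volume (C ∩ Metric.ball x ε) - volume (C' ∩ Metric.ball x ε)) := by
  have h1 : Metric.ball x ε \ C = Prod.mk x ⁻¹' separatedPairs C ε := by
    ext y; rw [mem_separatedPairs, Set.mem_sdiff]; tauto
  have h2 : C' ∩ Metric.ball x ε = Prod.mk x ⁻¹' separatedPairs C' ε := by
    ext y; rw [mem_separatedPairs, mem_inter_iff]; tauto
  rw [← Measure.addHaar_ball_center volume x, ← measure_inter_add_sdiff (Metric.ball x ε) hC, h1,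
    ← h2, inter_comm, add_comm, add_assoc]
  gcongr
  exact le_add_tsub

lemma volume_mul_symmDiff_le (hC : MeasurableSet C) (hC' : MeasurableSet C') (ε : ℝ) :
    volume (Metric.ball (0 : EuclideanSpace ℝ (Fin d)) ε) * volume (symmDiff C C') ≤
      (∫⁻ x, volume (Prod.mk x ⁻¹' separatedPairs C ε)) +
      (∫⁻ x, volume (Prod.mk x ⁻¹' separatedPairs C' ε)) +
      ∫⁻ x, ((volume (C ∩ Metric.ball x ε) - volume (C' ∩ Metric.ball x ε)) +
        (volume (C' ∩ Metric.ball x ε) - volume (C ∩ Metric.ball x ε))) := by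
  have m1 := measurable_measure_prodMk_left (ν := (volume : Measure (EuclideanSpace ℝ (Fin d))))
    (measurableSet_separatedPairs hC ε)
  have m2 := measurable_measure_prodMk_left (ν := (volume : Measure (EuclideanSpace ℝ (Fin d))))
    (measurableSet_separatedPairs hC' ε)
  have m3 : Measurable fun x => volume (Prod.mk x ⁻¹' separatedPairs C ε) +
      volume (Prod.mk x ⁻¹' separatedPairs C' ε) := m1.add m2
  rw [← lintegral_indicator_const (hC.symmDiff hC'), ← lintegral_add_left m1,
    ← lintegral_add_left m3]
  refine lintegral_mono fun x => ?_
  by_cases hx : x ∈ symmDiff C C'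
  · rw [indicator_of_mem hx]
    rcases hx with hx | hx
    · exact (volume_ball_le_of_mem_diff hC hx.1 hx.2).trans (add_le_add_right le_self_add _)
    · refine (volume_ball_le_of_mem_diff hC' hx.1 hx.2).trans ?_
      rw [add_comm (volume (Prod.mk x ⁻¹' separatedPairs C' ε))]
      exact add_le_add_right le_add_self _
  · rw [indicator_of_notMem hx]
    exact zero_le

/-- Weak compactness of indicator functions. -/
lemma exists_subseq_tendsto_volume_inter_ball {D : ℕ → Set (EuclideanSpace ℝ (Fin d))}
    (hD : ∀ n, MeasurableSet (D n)) {V : ℝ≥0∞} (hV : V ≠ ⊤) (hDV : ∀ n, volume (D n) ≤ V) :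
    ∃ φ : ℕ → ℕ, StrictMono φ ∧ ∀ (x : EuclideanSpace ℝ (Fin d)) (ε : ℝ), ∃ a : ℝ≥0∞, a ≠ ⊤ ∧
      Tendsto (fun n => volume (D (φ n) ∩ Metric.ball x ε)) atTop (𝓝 a) := by
  have hDf : ∀ n, volume (D n) ≠ ⊤ := fun n => ne_top_of_le_ne_top hV (hDV n)
  set u : ℕ → Lp ℝ 2 (volume : Measure (EuclideanSpace ℝ (Fin d))) := fun n =>
    indicatorConstLp 2 (hD n) (hDf n) 1
  have hu : ∀ n, ‖u n‖ ≤ V.toReal ^ (1 / (2 : ℝ)) := by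
    intro n
    rw [norm_indicatorConstLp (by norm_num) (by norm_num), norm_one, one_mul]
    exact Real.rpow_le_rpow measureReal_nonneg (ENNReal.toReal_mono hV (hDV n)) (by norm_num)
  -- A finite exponent makes `L²` separable, as sequential Banach–Alaoglu requires. Volumes in balls
  -- are then pairings with indicators of balls.
  have : Fact ((2 : ℝ≥0∞) ≠ ⊤) := ⟨by norm_num⟩
  have hcomp := WeakDual.isSeqCompact_closedBall ℝ
    (Lp ℝ 2 (volume : Measure (EuclideanSpace ℝ (Fin d)))) 0 (V.toReal ^ (1 / (2 : ℝ)))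
  obtain ⟨w, -, φ, hφ, hlim⟩ := hcomp
    (x := fun n => StrongDual.toWeakDual (innerSL ℝ (u n))) (fun n => by
      rw [mem_preimage, mem_closedBall_zero_iff]
      exact (innerSL_apply_norm ℝ (u n)).trans_le (hu n))
  refine ⟨φ, hφ, fun x ε => ?_⟩
  have hb : volume (Metric.ball x ε) ≠ ⊤ := measure_ball_lt_top.ne
  have h1 := ((WeakDual.eval_continuous (indicatorConstLp 2
    (measurableSet_ball (x := x) (ε := ε)) hb (1 : ℝ))).tendsto w).comp hlim
  have h2 : ∀ n, volume (D (φ n) ∩ Metric.ball x ε) = ENNReal.ofReal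
      (innerSL ℝ (u (φ n)) (indicatorConstLp 2 (measurableSet_ball (x := x) (ε := ε)) hb (1 : ℝ))) := by
    intro n
    rw [innerSL_apply_apply, L2.real_inner_indicatorConstLp_one_indicatorConstLp_one (hD _) measurableSet_ball (hDf _)
        hb,
      ofReal_measureReal (ne_top_of_le_ne_top hb (measure_mono inter_subset_right))]
  simp only [h2]
  exact ⟨_, ENNReal.ofReal_ne_top, ENNReal.tendsto_ofReal h1⟩

/-- Dominated convergence: each volume is at most that of the ball and vanishes when `x` is far from
`Ω`. Finiteness of `a` makes truncated subtraction continuous there. -/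
lemma tendsto_lintegral_volume_inter_ball_sub {Ω : Set (EuclideanSpace ℝ (Fin d))}
    (hΩ : IsBounded Ω) {D : ℕ → Set (EuclideanSpace ℝ (Fin d))} (hD : ∀ n, MeasurableSet (D n))
    (hDΩ : ∀ n, D n ⊆ Ω) {ε : ℝ} {a : EuclideanSpace ℝ (Fin d) → ℝ≥0∞} (ha : ∀ x, a x ≠ ⊤)
    (hlim : ∀ x, Tendsto (fun n => volume (D n ∩ Metric.ball x ε)) atTop (𝓝 (a x))) :
    Tendsto (fun p : ℕ × ℕ => ∫⁻ x, ((volume (D p.1 ∩ Metric.ball x ε) -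
      volume (D p.2 ∩ Metric.ball x ε)) + (volume (D p.2 ∩ Metric.ball x ε) -
        volume (D p.1 ∩ Metric.ball x ε)))) (atTop ×ˢ atTop) (𝓝 0) := by
  obtain ⟨R, hR⟩ := hΩ.subset_ball 0
  set V := volume (Metric.ball (0 : EuclideanSpace ℝ (Fin d)) ε)
  have hV : V ≠ ⊤ := measure_ball_lt_top.ne
  have hle : ∀ n x, volume (D n ∩ Metric.ball x ε) ≤
      (Metric.ball 0 (R + ε)).indicator (fun _ => V) x := by
    intro n x
    by_cases hx : x ∈ Metric.ball (0 : EuclideanSpace ℝ (Fin d)) (R + ε)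
    · rw [indicator_of_mem hx]
      exact (measure_mono inter_subset_right).trans_eq (Measure.addHaar_ball_center _ _ _)
    · have : D n ∩ Metric.ball x ε = ∅ := by
        refine eq_empty_of_forall_notMem fun y hy => hx ?_
        have h1 := hR (hDΩ n hy.1)
        have h2 := hy.2
        rw [Metric.mem_ball] at h1 h2 ⊢
        have := dist_triangle_left x 0 y
        linarith
      simp [this]
  have hmeas : ∀ n, Measurable fun x => volume (D n ∩ Metric.ball x ε) := by
    intro n
    have : MeasurableSet {p : EuclideanSpace ℝ (Fin d) × EuclideanSpace ℝ (Fin d) |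
        p.2 ∈ D n ∧ dist p.2 p.1 < ε} :=
      (measurable_snd (hD n)).inter
        (measurableSet_lt (measurable_snd.dist measurable_fst) measurable_const)
    exact measurable_measure_prodMk_left (ν := volume) this
  have h0 : ∫⁻ _ : EuclideanSpace ℝ (Fin d), (0 : ℝ≥0∞) = 0 := lintegral_zero
  rw [← h0]
  refine tendsto_lintegral_filter_of_dominated_convergence
    (fun x => (Metric.ball 0 (R + ε)).indicator (fun _ => V) x +
      (Metric.ball 0 (R + ε)).indicator (fun _ => V) x)
    (Eventually.of_forall fun p => ((hmeas _).sub (hmeas _)).add ((hmeas _).sub (hmeas _)))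
    (Eventually.of_forall fun p => Eventually.of_forall fun x =>
      add_le_add (tsub_le_self.trans (hle _ x)) (tsub_le_self.trans (hle _ x))) ?_
    (Eventually.of_forall fun x => ?_)
  · have hm : Measurable ((Metric.ball (0 : EuclideanSpace ℝ (Fin d)) (R + ε)).indicator
        fun _ => V) := measurable_const.indicator measurableSet_ball
    rw [lintegral_add_left hm, lintegral_indicator_const measurableSet_ball]
    exact (ENNReal.add_lt_top.2 ⟨ENNReal.mul_lt_top hV.lt_top measure_ball_lt_top,
      ENNReal.mul_lt_top hV.lt_top measure_ball_lt_top⟩).ne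
  · have t1 := (hlim x).comp (tendsto_fst (f := atTop (α := ℕ)) (g := atTop (α := ℕ)))
    have t2 := (hlim x).comp (tendsto_snd (f := atTop (α := ℕ)) (g := atTop (α := ℕ)))
    have := (ENNReal.Tendsto.sub t1 t2 (Or.inl (ha x))).add
      (ENNReal.Tendsto.sub t2 t1 (Or.inl (ha x)))
    simpa using this

lemma exists_forall_volume_symmDiff_le {Ω : Set (EuclideanSpace ℝ (Fin d))}
    (hΩ : IsBounded Ω) {D : ℕ → Set (EuclideanSpace ℝ (Fin d))} (hD : ∀ n, MeasurableSet (D n))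
    (hDΩ : ∀ n, D n ⊆ Ω) {P : ℝ≥0∞} (hP : P ≠ ⊤) (hDP : ∀ n, perimeter (D n) ≤ P)
    (hlim : ∀ (x : EuclideanSpace ℝ (Fin d)) (ε : ℝ), ∃ a : ℝ≥0∞, a ≠ ⊤ ∧
      Tendsto (fun n => volume (D n ∩ Metric.ball x ε)) atTop (𝓝 a))
    {δ : ℝ} (hδ : 0 < δ) :
    ∃ N, ∀ n ≥ N, ∀ m ≥ N, volume (symmDiff (D n) (D m)) ≤ ENNReal.ofReal δ := by
  -- At this radius each separation term is at most `V * δ / 4`; the local volumes provide `V * δ /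
  -- 2`, and `V` is divided out at the end.
  set ε : ℝ := δ / (4 * (P.toReal + 1)) with hε
  have hP0 : 0 ≤ P.toReal := ENNReal.toReal_nonneg
  have hε0 : 0 < ε := by positivity
  have hεP : ε * P.toReal ≤ δ / 4 := by
    rw [hε, div_mul_eq_mul_div, div_le_div_iff₀ (by positivity) (by positivity)]
    nlinarith
  set V := volume (Metric.ball (0 : EuclideanSpace ℝ (Fin d)) ε)
  have hV : V ≠ ⊤ := measure_ball_lt_top.ne
  have hV0 : V ≠ 0 := (Metric.measure_ball_pos _ _ hε0).ne'
  choose a ha hal using fun x => hlim x ε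
  have hδ2 : 0 < V * ENNReal.ofReal (δ / 2) :=
    ENNReal.mul_pos hV0 (ENNReal.ofReal_pos.2 (by positivity)).ne'
  have hev := (tendsto_lintegral_volume_inter_ball_sub hΩ hD hDΩ ha hal).eventually
    (gt_mem_nhds hδ2)
  rw [prod_atTop_atTop_eq] at hev
  obtain ⟨⟨N, N'⟩, hN⟩ := eventually_atTop.1 hev
  refine ⟨max N N', fun n hn m hm => ?_⟩
  have h3 := (hN (n, m) ⟨(le_max_left _ _).trans hn, (le_max_right _ _).trans hm⟩).le
  have hsep : ∀ n, ∫⁻ x, volume (Prod.mk x ⁻¹' separatedPairs (D n) ε) ≤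
      V * ENNReal.ofReal (δ / 4) := by
    intro n
    refine (volume_separatedPairs_le (hD n)
      (ne_top_of_le_ne_top hΩ.measure_lt_top.ne (measure_mono (hDΩ n)))
      (ne_top_of_le_ne_top hP (hDP n)) ε).trans ?_
    gcongr
    refine le_trans ?_ hεP
    gcongr
    exact hDP n
  have h := (volume_mul_symmDiff_le (hD n) (hD m) ε).trans
    (add_le_add (add_le_add (hsep n) (hsep m)) h3)
  rw [← mul_add, ← mul_add, ← ENNReal.ofReal_add (by positivity) (by positivity),
    ← ENNReal.ofReal_add (by positivity) (by positivity)] at h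
  have h' := (ENNReal.mul_le_mul_iff_right hV0 hV).1 h
  refine h'.trans_eq ?_
  congr 1
  ring

/-- Compactness of sets of bounded perimeter: some subsequence converges in measure, with the
differences to the limit contained in a decreasing sequence of sets with null intersection. -/
theorem exists_subseq_symmDiff_subset {Ω : Set (EuclideanSpace ℝ (Fin d))}
    (hΩ : IsBounded Ω) {D : ℕ → Set (EuclideanSpace ℝ (Fin d))} (hD : ∀ n, MeasurableSet (D n))
    (hDΩ : ∀ n, D n ⊆ Ω) {P : ℝ≥0∞} (hP : P ≠ ⊤) (hDP : ∀ n, perimeter (D n) ≤ P) :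
    ∃ (φ : ℕ → ℕ) (C : Set (EuclideanSpace ℝ (Fin d))) (B : ℕ → Set (EuclideanSpace ℝ (Fin d))),
      StrictMono φ ∧ MeasurableSet C ∧ C ⊆ Ω ∧ Antitone B ∧ volume (⋂ n, B n) = 0 ∧
        ∀ n, symmDiff (D (φ n)) C ⊆ B n := by
  obtain ⟨φ, hφ, hlim⟩ := exists_subseq_tendsto_volume_inter_ball hD hΩ.measure_lt_top.ne
    fun n => measure_mono (hDΩ n)
  -- A geometric rate makes the measures of consecutive differences summable, for Borel–Cantelli.
  have hfast : ∀ k : ℕ, ∃ N, ∀ n ≥ N, ∀ m ≥ n,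
      volume (symmDiff (D (φ n)) (D (φ m))) ≤ ENNReal.ofReal ((1 / 2) ^ k) := by
    intro k
    obtain ⟨N, hN⟩ := exists_forall_volume_symmDiff_le hΩ (fun n => hD (φ n))
      (fun n => hDΩ (φ n)) hP (fun n => hDP (φ n)) hlim
      (by positivity : (0 : ℝ) < (1 / 2) ^ k)
    exact ⟨N, fun n hn m hm => hN n hn m (hn.trans hm)⟩
  obtain ⟨ψ, hψ, hψfast⟩ := extraction_forall_of_eventually' hfast
  set A : ℕ → Set (EuclideanSpace ℝ (Fin d)) := fun n => D (φ (ψ n)) with hA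
  set s : ℕ → Set (EuclideanSpace ℝ (Fin d)) := fun k => symmDiff (A k) (A (k + 1)) with hs
  have hsum : ∑' k, volume (s k) ≠ ⊤ := by
    have hsm : Summable fun k : ℕ => ((1 : ℝ) / 2) ^ k := summable_geometric_two
    refine ne_top_of_le_ne_top (hsm.tsum_ofReal_ne_top) (ENNReal.tsum_le_tsum fun k => ?_)
    exact hψfast k _ (hψ (Nat.lt_succ_self k)).le
  have hnull := measure_limsup_atTop_eq_zero hsum
  rw [limsup_eq_iInf_iSup_of_nat] at hnull
  -- The limit is the set-theoretic liminf, and `B n` collects all changes of membership from index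
  -- `n` on.
  refine ⟨φ ∘ ψ, ⋃ n, ⋂ k ≥ n, A k, fun n => ⋃ k ≥ n, s k, hφ.comp hψ,
    MeasurableSet.iUnion fun n => MeasurableSet.iInter fun k => MeasurableSet.iInter fun _ =>
      hD _, ?_, fun m n h => biUnion_mono (fun k hk => le_trans h hk) fun _ _ => subset_rfl,
    by simpa only [iInf_eq_iInter, iSup_eq_iUnion] using hnull, fun n x hx => ?_⟩
  · refine iUnion_subset fun n => ?_
    exact fun x hx => hDΩ _ (mem_iInter₂.1 hx n le_rfl)
  · by_contra hxs
    have hstep : ∀ k ≥ n, (x ∈ A k ↔ x ∈ A (k + 1)) := by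
      intro k hk
      have : x ∉ s k := fun h => hxs (mem_iUnion₂.2 ⟨k, hk, h⟩)
      rw [hs, mem_symmDiff] at this
      tauto
    have hall : ∀ k ≥ n, (x ∈ A k ↔ x ∈ A n) := by
      intro k hk
      induction k, hk using Nat.le_induction with
      | base => rfl
      | succ k hk ih => exact (hstep k hk).symm.trans ih
    have hC : x ∈ (⋃ n, ⋂ k ≥ n, A k) ↔ x ∈ A n := by
      simp only [mem_iUnion, mem_iInter]
      constructor
      · rintro ⟨m, hm⟩
        exact (hall _ (le_max_right m n)).1 (hm _ (le_max_left m n))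
      · exact fun h => ⟨n, fun k hk => (hall k hk).2 h⟩
    rw [mem_symmDiff, hC] at hx
    change (x ∈ A n ∧ x ∉ A n ∨ x ∈ A n ∧ x ∉ A n) at hx
    tauto

end Compactness

/-! ### Negligibility of the boundary -/

section Domain

variable {d : ℕ}

/-- The graph of a continuous function over a hyperplane is negligible. -/
lemma volume_graph_eq_zero {v : EuclideanSpace ℝ (Fin d)} (hv : ‖v‖ = 1)
    {g : EuclideanSpace ℝ (Fin d) → ℝ} (hg : Continuous g) :
    volume {x : EuclideanSpace ℝ (Fin d) | g (x - ⟪v, x⟫_ℝ • v) = ⟪v, x⟫_ℝ} = 0 := by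
  have hvv : ⟪v, v⟫_ℝ = 1 := by rw [real_inner_self_eq_norm_sq, hv, one_pow]
  -- Infinitely many vertical translates of the graph, by a bounded sequence of vectors, are
  -- pairwise disjoint; this forces measure zero.
  have hu : Tendsto (fun n : ℕ => (1 / ((n : ℝ) + 1)) • v) atTop (𝓝 ((0 : ℝ) • v)) :=
    tendsto_one_div_add_atTop_nhds_zero_nat.smul_const v
  refine Measure.addHaar_eq_zero_of_disjoint_translates volume _
    (Metric.isBounded_range_of_tendsto _ hu) (fun m n hmn => ?_)
    (measurableSet_eq_fun (by fun_prop) (by fun_prop))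
  simp only [Function.onFun, singleton_add]
  rw [disjoint_left]
  rintro _ ⟨x, hx, rfl⟩ ⟨y, hy, hxy⟩
  have hproj : ∀ (t : ℝ) (z : EuclideanSpace ℝ (Fin d)),
      (t • v + z) - ⟪v, t • v + z⟫_ℝ • v = z - ⟪v, z⟫_ℝ • v := by
    intro t z
    rw [inner_add_right, inner_smul_right, hvv, add_smul, mul_one]
    abel
  have h1 := congrArg (fun z => z - ⟪v, z⟫_ℝ • v) hxy
  simp only [hproj] at h1
  have h2 : ⟪v, y⟫_ℝ = ⟪v, x⟫_ℝ := by
    rw [← (hx : g _ = _), ← (hy : g _ = _), h1]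
  have h3 := congrArg (fun z => ⟪v, z⟫_ℝ) hxy
  simp only [inner_add_right, inner_smul_right, hvv, h2, mul_one, add_left_inj] at h3
  rw [one_div, one_div, inv_inj, add_left_inj, Nat.cast_inj] at h3
  exact hmn h3.symm

/-- Near a boundary point the frontier lies in a graph: a frontier point is outside the open set
`Ω`, hence not above the graph, and it is a limit of points above. -/
lemma IsBoundedLipschitzDomain.volume_frontier {Ω : Set (EuclideanSpace ℝ (Fin d))}
    (hΩ : IsBoundedLipschitzDomain Ω) : volume (frontier Ω) = 0 := by
  refine measure_null_of_locally_null _ fun p hp => ?_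
  obtain ⟨v, g, L, r, hv, hg, hr, h⟩ := hΩ.lipschitz_boundary p hp
  refine ⟨frontier Ω ∩ Metric.ball p r,
    inter_mem self_mem_nhdsWithin (mem_nhdsWithin_of_mem_nhds (Metric.ball_mem_nhds p hr)),
    measure_mono_null ?_ (volume_graph_eq_zero hv hg.continuous)⟩
  rintro x ⟨hx, hxb⟩
  have hxΩ : x ∉ Ω := by
    rw [hΩ.isOpen.frontier_eq] at hx
    exact hx.2
  have hc : Continuous fun x : EuclideanSpace ℝ (Fin d) => g (x - ⟪v, x⟫_ℝ • v) :=
    hg.continuous.comp (by fun_prop)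
  have hc' : Continuous fun x : EuclideanSpace ℝ (Fin d) => ⟪v, x⟫_ℝ := by fun_prop
  refine le_antisymm ?_ (not_lt.1 fun h' => hxΩ ((h x hxb).2 h'))
  have hcl : x ∈ closure (Metric.ball p r ∩ Ω) :=
    Metric.isOpen_ball.inter_closure ⟨hxb, frontier_subset_closure hx⟩
  exact closure_minimal (fun y hy => ((h y hy.1).1 hy.2).le) (isClosed_le hc hc') hcl

end Domain

/-! ### The direct method -/

section Main

variable {d : ℕ} {Ω C C' : Set (EuclideanSpace ℝ (Fin d))}
  {fp fm : Measure (EuclideanSpace ℝ (Fin d))} {H₁ H₂ : EuclideanSpace ℝ (Fin d) → ℝ≥0∞} {k : ℝ}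

lemma penalizedCost_congr_set (h : C =ᵐ[volume] C') :
    penalizedCost Ω fp fm H₁ H₂ k C = penalizedCost Ω fp fm H₁ H₂ k C' := by
  rw [penalizedCost, penalizedCost, transportCost_congr_set h, perimeter_congr h]

/-- Among the measurable subsets of a bounded measurable set, one minimizes the penalized cost, as
soon as one has finite penalized cost. -/
theorem exists_isMinOn_penalizedCost (hΩ : IsBounded Ω) (hΩm : MeasurableSet Ω)
    (hH₁ : IsCongestionFunction H₁) (hH₂ : IsCongestionFunction H₂) (hH : ∀ s, H₁ s ≤ H₂ s)
    (hk : 0 < k) (hfin : ∃ C ⊆ Ω, MeasurableSet C ∧ penalizedCost Ω fp fm H₁ H₂ k C < ⊤) :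
    ∃ C ⊆ Ω, MeasurableSet C ∧ penalizedCost Ω fp fm H₁ H₂ k C < ⊤ ∧
      ∀ C' ⊆ Ω, MeasurableSet C' →
        penalizedCost Ω fp fm H₁ H₂ k C ≤ penalizedCost Ω fp fm H₁ H₂ k C' := by
  set m : ℝ≥0∞ := ⨅ C ∈ {C | C ⊆ Ω ∧ MeasurableSet C}, penalizedCost Ω fp fm H₁ H₂ k C with hm
  have hmle : ∀ C' ⊆ Ω, MeasurableSet C' → m ≤ penalizedCost Ω fp fm H₁ H₂ k C' :=
    fun C' h1 h2 => iInf₂_le C' ⟨h1, h2⟩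
  have hmtop : m < ⊤ := by
    obtain ⟨C, h1, h2, h3⟩ := hfin
    exact (hmle C h1 h2).trans_lt h3
  suffices h : ∃ C ⊆ Ω, MeasurableSet C ∧ penalizedCost Ω fp fm H₁ H₂ k C ≤ m by
    obtain ⟨C, h1, h2, h3⟩ := h
    exact ⟨C, h1, h2, h3.trans_lt hmtop, fun C' h1' h2' => h3.trans (hmle C' h1' h2')⟩
  have hex : ∀ n : ℕ, ∃ C, (C ⊆ Ω ∧ MeasurableSet C) ∧
      penalizedCost Ω fp fm H₁ H₂ k C < m + ((n : ℝ≥0∞) + 1)⁻¹ := by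
    intro n
    have : m < m + ((n : ℝ≥0∞) + 1)⁻¹ := ENNReal.lt_add_right hmtop.ne (by simp)
    nth_rw 1 [hm] at this
    simp only [iInf_lt_iff, exists_prop] at this
    exact this
  choose D hDΩ hDm using hex
  have hlim : Tendsto (fun n : ℕ => m + ((n : ℝ≥0∞) + 1)⁻¹) atTop (𝓝 m) := by
    have : Tendsto (fun n : ℕ => (((n + 1 : ℕ) : ℝ≥0∞))⁻¹) atTop (𝓝 0) :=
      ENNReal.tendsto_inv_nat_nhds_zero.comp (tendsto_add_atTop_nat 1)
    simpa using this.const_add m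
  have hM : m + 1 < ⊤ := ENNReal.add_lt_top.2 ⟨hmtop, ENNReal.one_lt_top⟩
  have hDM : ∀ n, penalizedCost Ω fp fm H₁ H₂ k (D n) ≤ m + 1 := fun n =>
    (hDm n).le.trans (add_le_add_right (ENNReal.inv_le_one.2 (by simp)) _)
  have hk0 : ENNReal.ofReal k ≠ 0 := (ENNReal.ofReal_pos.2 hk).ne'
  have hper : ∀ n, perimeter (D n) ≤ (m + 1) / ENNReal.ofReal k := fun n => by
    rw [ENNReal.le_div_iff_mul_le (Or.inl hk0) (Or.inl ENNReal.ofReal_ne_top), mul_comm]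
    exact le_add_self.trans (hDM n)
  -- Compactness of `[0, ∞]` gives the cost and the perimeter separate limits, so that each can be
  -- compared with its value at `C`.
  obtain ⟨φ₁, hφ₁, a, hF⟩ : ∃ φ : ℕ → ℕ, StrictMono φ ∧ ∃ a, Tendsto
      (fun n => transportCost Ω fp fm H₁ H₂ (D (φ n))) atTop (𝓝 a) := by
    obtain ⟨a, -, φ, hφ, h⟩ := isCompact_univ.tendsto_subseq
      (x := fun n => transportCost Ω fp fm H₁ H₂ (D n)) fun n => mem_univ _
    exact ⟨φ, hφ, a, h⟩
  obtain ⟨φ₂, hφ₂, p, hp⟩ : ∃ φ : ℕ → ℕ, StrictMono φ ∧ ∃ p, Tendsto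
      (fun n => perimeter (D (φ₁ (φ n)))) atTop (𝓝 p) := by
    obtain ⟨p, -, φ, hφ, h⟩ := isCompact_univ.tendsto_subseq
      (x := fun n => perimeter (D (φ₁ n))) fun n => mem_univ _
    exact ⟨φ, hφ, p, h⟩
  obtain ⟨φ₃, C, B, hφ₃, hCm, hCΩ, hB, hB0, hDB⟩ := exists_subseq_symmDiff_subset hΩ
    (D := fun n => D (φ₁ (φ₂ n))) (fun n => (hDΩ _).2) (fun n => (hDΩ _).1)
    (ENNReal.div_ne_top hM.ne hk0) (fun n => hper _)
  have hF' := hF.comp (hφ₂.comp hφ₃).tendsto_atTop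
  have hp' := hp.comp hφ₃.tendsto_atTop
  refine ⟨C, hCΩ, hCm, ?_⟩
  have h1 : transportCost Ω fp fm H₁ H₂ C ≤ a := by
    refine (transportCost_le_limsup hΩ hΩm hH₁ hH₂ hH hB hB0 hDB hM
      fun n => le_self_add.trans (hDM _)).trans_eq ?_
    exact hF'.limsup_eq
  have h2 : perimeter C ≤ p := perimeter_le_of_tendsto (fun n => (hDΩ _).2) hCm hB hB0 hDB hp'
  have h3 : a + ENNReal.ofReal k * p ≤ m := by
    refine le_of_tendsto_of_tendsto'
      (hF'.add (ENNReal.Tendsto.const_mul hp' (Or.inr ENNReal.ofReal_ne_top)))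
      (hlim.comp (hφ₁.comp (hφ₂.comp hφ₃)).tendsto_atTop) fun n => (hDm _).le
  exact (add_le_add h1 (by gcongr)).trans h3

end Main

end CongestedTransport

theorem theorem2p1 {d : ℕ} (Ω : Set (EuclideanSpace ℝ (Fin d)))
    (hΩ : CongestedTransport.IsBoundedLipschitzDomain Ω)
    (fp fm : Measure (EuclideanSpace ℝ (Fin d)))
    [IsProbabilityMeasure fp] [IsProbabilityMeasure fm]
    (hfp : fp (closure Ω)ᶜ = 0) (hfm : fm (closure Ω)ᶜ = 0)
    (H₁ H₂ : EuclideanSpace ℝ (Fin d) → ℝ≥0∞)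
    (hH₁ : CongestedTransport.IsCongestionFunction H₁)
    (hH₂ : CongestedTransport.IsCongestionFunction H₂)
    (hH : ∀ s, H₁ s ≤ H₂ s)
    (k : ℝ) (hk : 0 < k)
    (hfin : ∃ C ⊆ closure Ω, NullMeasurableSet C volume ∧ CongestedTransport.perimeter C < ⊤ ∧
      CongestedTransport.transportCost Ω fp fm H₁ H₂ C < ⊤) :
    -- the minimum that defines `F(C)` is attained whenever `F(C)` is finite
    (∀ C ⊆ Ω, NullMeasurableSet C volume →
      CongestedTransport.transportCost Ω fp fm H₁ H₂ C < ⊤ →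
      ∃ σ ∈ CongestedTransport.admissibleFluxes Ω fp fm,
        CongestedTransport.fluxCost Ω H₁ H₂ C σ =
          CongestedTransport.transportCost Ω fp fm H₁ H₂ C) ∧
    -- there is an optimal set, and the minimal value is finite
    ∃ Copt ⊆ Ω, NullMeasurableSet Copt volume ∧
      CongestedTransport.penalizedCost Ω fp fm H₁ H₂ k Copt < ⊤ ∧
      ∀ C ⊆ Ω, NullMeasurableSet C volume →
        CongestedTransport.penalizedCost Ω fp fm H₁ H₂ k Copt ≤
          CongestedTransport.penalizedCost Ω fp fm H₁ H₂ k C := by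

  have hb := hΩ.isBounded
  have hm := hΩ.isOpen.measurableSet
  refine ⟨fun C _ _ hC =>
    CongestedTransport.exists_flux_fluxCost_eq_transportCost hb hm hH₁ hH₂ hH hC, ?_⟩
  -- Lebesgue measurable sets reduce to Borel ones: a Borel subset of full measure stays inside `Ω`
  -- and has the same penalized cost.
  have hmeas : ∀ C ⊆ Ω, NullMeasurableSet C volume → ∃ C' ⊆ Ω, MeasurableSet C' ∧
      CongestedTransport.penalizedCost Ω fp fm H₁ H₂ k C' =
        CongestedTransport.penalizedCost Ω fp fm H₁ H₂ k C := by
    intro C hC hCm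
    obtain ⟨C', h1, h2, h3⟩ := hCm.exists_measurable_subset_ae_eq
    exact ⟨C', h1.trans hC, h2, CongestedTransport.penalizedCost_congr_set h3⟩
  have hfin' : ∃ C ⊆ Ω, MeasurableSet C ∧
      CongestedTransport.penalizedCost Ω fp fm H₁ H₂ k C < ⊤ := by
    obtain ⟨C, hC, hCm, hCp, hCF⟩ := hfin
    -- The discarded part of the competitor lies in the null frontier.
    have hae : (C ∩ Ω : Set (EuclideanSpace ℝ (Fin d))) =ᵐ[volume] C := by
      refine EventuallyLE.antisymm inter_subset_left.eventuallyLE ?_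
      rw [ae_le_set, sdiff_self_inter]
      refine measure_mono_null ?_ hΩ.volume_frontier
      rw [hΩ.isOpen.frontier_eq]
      exact sdiff_subset_sdiff_left hC
    obtain ⟨C', h1, h2, h3⟩ := hmeas (C ∩ Ω) inter_subset_right
      (hCm.inter hm.nullMeasurableSet)
    refine ⟨C', h1, h2, ?_⟩
    rw [h3, CongestedTransport.penalizedCost_congr_set hae]
    exact ENNReal.add_lt_top.2 ⟨hCF, ENNReal.mul_lt_top ENNReal.ofReal_lt_top hCp⟩
  obtain ⟨C, hCΩ, hCm, hCfin, hCmin⟩ :=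
    CongestedTransport.exists_isMinOn_penalizedCost hb hm hH₁ hH₂ hH hk hfin'
  refine ⟨C, hCΩ, hCm.nullMeasurableSet, hCfin, fun C' hC' hCm' => ?_⟩
  obtain ⟨C'', h1, h2, h3⟩ := hmeas C' hC' hCm'
  exact (hCmin C'' h1 h2).trans_eq h3
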